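/- Consider finite hypergraphs $H=(V,\mathcal E)$, where $\mathcal E$ is a family of subsets of $V$ (equal hyperedges may occur several times and then count as distinct), whose incidence graph $\mathcal I(H)$ (the bipartite graph on $V\cup\mathcal E$ with $v$ adjacent to $E$ iff $v\in E$) is connected. Let $N=\sum_{E\in\mathcal E}|E|$. The hypergraph $H$ is $\gamma$-acyclic if $\mathcal I(H)$ is distance-hereditary, i.e. every connected induced subgraph of $\mathcal I(H)$ preserves the distances of $\mathcal I(H)$ between its vertices. A join tree of $H$ is a tree $T$ whose nodes are the hyperedges of $H$ such that for each $v\in V$ the hyperedges containing $v$ induce a connected subgraph of $T$. The union join graph $G$ of $H$ is the graph with vertex set $\mathcal E$ in which two hyperedges are adjacent iff they are adjacent in some join tree of $H$; its size $|G|$ is its number of vertices plus its number of edges. The line graph $L(H)$ has vertex set $\mathcal E$, two distinct hyperedges being adjacent iff they intersect. The dual $H^*$ has vertex set $\mathcal E$ and, for each $v\in V$, the hyperedge $\{E\in\mathcal E : v\in E\}$. The 2-section of a hypergraph has the same vertices as the hypergraph, two distinct vertices being adjacent iff some hyperedge contains both. Theorem. If $H$ is $\gamma$-acyclic, then its union join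 graph $G$ equals its line graph, which is the 2-section of $H^*$, and $H^*$ is again $\gamma$-acyclic. Moreover, there is an algorithm that, given a $\gamma$-acyclic hypergraph $H$ by its incidence graph, computes $G$ in $\mathcal O(N+|G|)$ time. Explicitly: there are a single program for a random access machine (registers and arrays of natural numbers; unit-cost operations: load a constant, copy, add one, subtract one (truncated at zero), read and write an array cell, compare two registers) and a constant $C$ such that, for every $\gamma$-acyclic hypergraph $H$ with vertices $0,\dots,n-1$ and hyperedges $0,\dots,m-1$, started on $n$, $m$ and a list, in arbitrary order and without repetition, of the $N$ incident pairs $(v,E)$, the program halts after at most $C\,(N+|G|+1)$ steps with $m$ and a list that contains each edge of $G$ exactly once. -/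

import Mathlib

/-! ### Hypergraphs -/

/-- A hypergraph with vertex set `V` whose hyperedges are indexed by `E`.  Hyperedges form a family:
two different indices are distinct hyperedges even if they contain the same vertices. -/
structure FamHypergraph (V E : Type*) where
  /-- the set of vertices contained in a hyperedge -/
  edge : E → Set V

namespace FamHypergraph

/-- Incidence of a vertex-node with a hyperedge-node. -/
def IncAdj {V E : Type*} (H : FamHypergraph V E) : V ⊕ E → V ⊕ E → Prop
  | Sum.inl v, Sum.inr e => v ∈ H.edge e
  | Sum.inr e, Sum.inl v => v ∈ H.edge e
  | _, _ => False

/-- The bipartite incidence graph: `v` and `e` are adjacent iff `v` is in the hyperedge `e`. -/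
def incidenceGraph {V E : Type*} (H : FamHypergraph V E) : SimpleGraph (V ⊕ E) where
  Adj := H.IncAdj
  symm := ⟨by
    rintro (v | e) (w | f) h
    · exact h
    · exact h
    · exact h
    · exact h⟩
  loopless := ⟨by
    rintro (v | e) h
    · exact h
    · exact h⟩

/-- The dual hypergraph: the roles of vertices and hyperedges are exchanged. -/
def dual {V E : Type*} (H : FamHypergraph V E) : FamHypergraph E V where
  edge v := {e | v ∈ H.edge e}

/-- The 2-section graph: two vertices are adjacent iff some hyperedge contains both. -/
def twoSection {V E : Type*} (H : FamHypergraph V E) : SimpleGraph V where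
  Adj u v := u ≠ v ∧ ∃ e, u ∈ H.edge e ∧ v ∈ H.edge e
  symm := ⟨fun _ _ h => ⟨h.1.symm, h.2.imp fun _ k => ⟨k.2, k.1⟩⟩⟩
  loopless := ⟨fun _ h => h.1 rfl⟩

/-- The line graph: the intersection graph of the hyperedges. -/
def lineGraph {V E : Type*} (H : FamHypergraph V E) : SimpleGraph E where
  Adj e f := e ≠ f ∧ (H.edge e ∩ H.edge f).Nonempty
  symm := ⟨fun _ _ h => ⟨h.1.symm, by rw [Set.inter_comm]; exact h.2⟩⟩
  loopless := ⟨fun _ h => h.1 rfl⟩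

/-- A join tree: a tree on the hyperedges in which, for each vertex `v`, the hyperedges
containing `v` induce a (connected) subtree. -/
def IsJoinTree {V E : Type*} (H : FamHypergraph V E) (T : SimpleGraph E) : Prop :=
  T.IsTree ∧ ∀ v : V, (T.induce {e | v ∈ H.edge e}).Preconnected

/-- The union join graph: two hyperedges are adjacent iff they are adjacent in some join tree. -/
def unionJoinGraph {V E : Type*} (H : FamHypergraph V E) : SimpleGraph E where
  Adj e f := ∃ T : SimpleGraph E, H.IsJoinTree T ∧ T.Adj e f
  symm := ⟨fun _ _ ⟨T, hT, h⟩ => ⟨T, hT, h.symm⟩⟩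
  loopless := ⟨fun _ ⟨T, _, h⟩ => T.loopless.irrefl _ h⟩

/-- The total size of all hyperedges. -/
noncomputable def totalSize {V E : Type*} [Fintype E] (H : FamHypergraph V E) : ℕ :=
  ∑ e, (H.edge e).ncard

end FamHypergraph

/-- A (connected) graph is distance-hereditary if the distance between two vertices is the same in
every connected induced subgraph that contains both. -/
def IsDistanceHereditary {W : Type*} (G : SimpleGraph W) : Prop :=
  ∀ S : Set W, (G.induce S).Connected → ∀ x y : S, (G.induce S).dist x y = G.dist x y

/-- A hypergraph is γ-acyclic if its incidence graph is distance-hereditary. -/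
def FamHypergraph.IsGammaAcyclic {V E : Type*} (H : FamHypergraph V E) : Prop :=
  IsDistanceHereditary H.incidenceGraph

/-- The size of a graph: number of vertices plus number of edges. -/
noncomputable def graphSize {W : Type*} (G : SimpleGraph W) : ℕ :=
  Nat.card W + G.edgeSet.ncard

/-! ### A random access machine

The memory consists of registers and arrays holding natural numbers.  A program is a finite object,
so it uses finitely many registers and arrays.  Each elementary operation and each test costs one
unit of time.  The only arithmetic is adding or subtracting one; hence after `t` steps no number
exceeds the largest number in the input or the program text by more than `t`, and unit cost hides
no computation with long numbers. -/

namespace RAM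

/-- Memory contents: `reg x` is register `x`, and `arr a i` is cell `i` of array `a`. -/
@[ext]
structure Memory where
  reg : ℕ → ℕ
  arr : ℕ → ℕ → ℕ

namespace Memory

/-- Overwrite register `x` by `v`. -/
def setReg (s : Memory) (x v : ℕ) : Memory :=
  { s with reg := Function.update s.reg x v }

/-- Overwrite cell `i` of array `a` by `v`. -/
def setArr (s : Memory) (a i v : ℕ) : Memory :=
  { s with arr := Function.update s.arr a (Function.update (s.arr a) i v) }

end Memory

/-- Elementary operations. -/
inductive Op
  /-- `x := c` for a constant `c` -/
  | const (x c : ℕ)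
  /-- `x := y` -/
  | copy (x y : ℕ)
  /-- `x := y + 1` -/
  | succ (x y : ℕ)
  /-- `x := y - 1`, where `0 - 1 = 0` -/
  | pred (x y : ℕ)
  /-- `x := a[y]` -/
  | load (x a y : ℕ)
  /-- `a[x] := y` -/
  | store (a x y : ℕ)

/-- The effect of an elementary operation. -/
def Op.apply : Op → Memory → Memory
  | .const x c, s => s.setReg x c
  | .copy x y, s => s.setReg x (s.reg y)
  | .succ x y, s => s.setReg x (s.reg y + 1)
  | .pred x y, s => s.setReg x (s.reg y - 1)
  | .load x a y, s => s.setReg x (s.arr a (s.reg y))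
  | .store a x y, s => s.setArr a (s.reg x) (s.reg y)

/-- Tests comparing two registers. -/
inductive Cond
  | eq (x y : ℕ)
  | lt (x y : ℕ)

/-- The outcome of a test. -/
def Cond.Holds : Cond → Memory → Prop
  | .eq x y, s => s.reg x = s.reg y
  | .lt x y, s => s.reg x < s.reg y

/-- Programs. -/
inductive Program
  | skip
  | op (o : Op)
  | seq (p q : Program)
  | ite (b : Cond) (p q : Program)
  | loop (b : Cond) (p : Program)

/-- `Exec p s t s'`: started in memory `s`, the program `p` halts after exactly `t` steps in
memory `s'`.  Here `loop b p` is `while b do p`. -/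
inductive Exec : Program → Memory → ℕ → Memory → Prop
  | skip (s : Memory) : Exec .skip s 1 s
  | op (o : Op) (s : Memory) : Exec (.op o) s 1 (o.apply s)
  | seq {p q : Program} {s s₁ s₂ : Memory} {t₁ t₂ : ℕ} :
      Exec p s t₁ s₁ → Exec q s₁ t₂ s₂ → Exec (.seq p q) s (t₁ + t₂) s₂
  | iteTrue {b : Cond} {p q : Program} {s s₁ : Memory} {t : ℕ} :
      b.Holds s → Exec p s t s₁ → Exec (.ite b p q) s (t + 1) s₁
  | iteFalse {b : Cond} {p q : Program} {s s₁ : Memory} {t : ℕ} :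
      ¬ b.Holds s → Exec q s t s₁ → Exec (.ite b p q) s (t + 1) s₁
  | loopDone {b : Cond} {p : Program} {s : Memory} :
      ¬ b.Holds s → Exec (.loop b p) s 1 s
  | loopStep {b : Cond} {p : Program} {s s₁ s₂ : Memory} {t₁ t₂ : ℕ} :
      b.Holds s → Exec p s t₁ s₁ → Exec (.loop b p) s₁ t₂ s₂ →
        Exec (.loop b p) s (t₁ + t₂ + 1) s₂

end RAM

/-! ### Input and output -/

/-- `L` lists the edges of the incidence graph of `H`, each exactly once, in arbitrary order. -/
def FamHypergraph.IsListing {n m : ℕ} (H : FamHypergraph (Fin n) (Fin m))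
    (L : List (Fin n × Fin m)) : Prop :=
  L.Nodup ∧ ∀ v e, (v, e) ∈ L ↔ v ∈ H.edge e

/-- The initial memory for a hypergraph with `n` vertices and `m` hyperedges given by a list of
incident pairs: registers 0, 1, 2 hold `n`, `m` and the length of the list, cell `k` of array 0
and of array 1 hold the vertex and the hyperedge of the `k`-th pair, all else is `0`. -/
def inputMemory {n m : ℕ} (L : List (Fin n × Fin m)) : RAM.Memory where
  reg x := if x = 0 then n else if x = 1 then m else if x = 2 then L.length else 0
  arr a k :=
    if h : k < L.length then
      if a = 0 then ((L[k]).1 : ℕ) else if a = 1 then ((L[k]).2 : ℕ) else 0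
    else 0

/-- The memory `s` holds the graph `G` on `{0, …, m - 1}`: register 1 holds `m`, register 3 holds
the number of edges, and the cells of arrays 2 and 3 with index below that number hold the two end
vertices of the edges of `G`, where each edge occurs exactly once. -/
def HoldsGraph {m : ℕ} (s : RAM.Memory) (G : SimpleGraph (Fin m)) : Prop :=
  s.reg 1 = m ∧
  ∃ L : List (Fin m × Fin m),
    s.reg 3 = L.length ∧
    (∀ (k : ℕ) (h : k < L.length),
      s.arr 2 k = ((L[k]).1 : ℕ) ∧ s.arr 3 k = ((L[k]).2 : ℕ)) ∧
    (L.map fun p => s(p.1, p.2)).Nodup ∧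
    ∀ z : Sym2 (Fin m), z ∈ L.map (fun p => s(p.1, p.2)) ↔ z ∈ G.edgeSet

/-! Distance-heredity enters in two local forms: (a) every walk between nonadjacent vertices at
distance 2 meets one of their common neighbours (`exists_common_neighbor`); (b) if `x` and `y` have
the same distance from `r` and are joined by a walk that stays farther from `r` than a neighbour `g`
of `x` one step closer to `r`, then `g` is also a neighbour of `y` (`adj_of_adj_of_walk`).

Graph equality. Give a pair `e`, `f` of hyperedges the weight `|e ∩ f|` and take a tree `T` on the
hyperedges of maximum weight. Let `e` and `f` intersect without being adjacent in `T`. By edge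
exchange, no step of the path of `T` between them weighs less than `|e ∩ f|`. If no step had the
intersection `e ∩ f`, every step would pass through a vertex outside `e ∩ f`, and the path would
lift to a walk in the incidence graph that avoids all common neighbours of `e` and `f`, against (a).
So some step has exactly this intersection. By induction on path lengths `T` is therefore a join
tree, and exchanging that step for `ef` gives another maximum tree, hence a join tree, containing
`ef`. Conversely, connectedness forbids join tree edges between disjoint hyperedges. The dual has an
isomorphic incidence graph.

Algorithm. Breadth-first search from hyperedge 0 gives levels and, for every other hyperedge `e`, a
parent vertex `p(e)` in `e` one step closer to the root. Order the hyperedges by level, then by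
decreasing number of vertices closer to the root, then by index. If `f` precedes `e` and meets it,
then `p(e)` lies in `f` (`down_mem_of_inter`). So the edges of the line graph are exactly the pairs
of some `e` with an earlier hyperedge at `p(e)`, each found once, at its later end. The hyperedges
at `p(e)` are `e` and neighbours of `e`, so the scanned lists have total length at most the number
of hyperedges plus twice the number of edges. Running times are proved in a program logic whose
assertions carry the remaining credits (`Runs`). -/

/-! ### Distance-hereditary graphs -/

section DistanceHereditary

variable {W : Type*} {G : SimpleGraph W}

/-- In a distance-hereditary graph, every walk between two nonadjacent vertices with a common
neighbour passes through a common neighbour. -/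
theorem IsDistanceHereditary.exists_common_neighbor (hG : IsDistanceHereditary G) {x y z : W}
    (hxy : x ≠ y) (hadj : ¬ G.Adj x y) (hxz : G.Adj x z) (hzy : G.Adj z y) (w : G.Walk x y) :
    ∃ u ∈ w.support, G.Adj x u ∧ G.Adj u y := by
  -- The support of `w` induces a connected subgraph, which must preserve the distance 2; the middle
  -- vertex of a shortest path inside it is the required one.
  have hS := w.connected_induce_support
  have hd : G.dist x y = 2 := by
    refine le_antisymm (SimpleGraph.dist_le (.cons hxz (.cons hzy .nil))) ?_
    exact w.reachable.one_lt_dist_of_ne_of_not_adj hxy hadj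
  have hdS := hG _ hS ⟨x, w.start_mem_support⟩ ⟨y, w.end_mem_support⟩
  obtain ⟨p, hp⟩ := hS.exists_walk_length_eq_dist ⟨x, w.start_mem_support⟩ ⟨y, w.end_mem_support⟩
  rw [hdS, hd] at hp
  match p, hp with
  | .cons (v := u) h₁ (.cons h₂ .nil), _ => exact ⟨u, u.2, h₁, h₂⟩

/-- Two vertices of equal distance from `r` that are joined by a walk which does not come closer
to `r` have the same neighbours one step closer to `r`. -/
theorem IsDistanceHereditary.adj_of_adj_of_walk (hG : IsDistanceHereditary G) (hc : G.Connected)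
    {r x y g : W} (hgx : G.Adj g x) (hy : G.dist r y = G.dist r g + 1) (w : G.Walk y x)
    (hw : ∀ z ∈ w.support, G.dist r g < G.dist r z) : G.Adj y g := by
  classical
  obtain ⟨p, hp⟩ := hc.exists_walk_length_eq_dist g r
  -- Follow `w` from `y` to `x`, step to `g`, then take a geodesic to `r`. The support of this walk
  -- contains a geodesic from `y` to `r`. Its first vertex `u` after `y` is too close to `r` to lie
  -- on `w`, and too far to lie on the geodesic beyond `g`, so `u = g`.
  set q : G.Walk y r := w.append (.cons hgx.symm p) with hq
  have hS := q.connected_induce_support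
  obtain ⟨c, hcl⟩ := hS.exists_walk_length_eq_dist ⟨y, q.start_mem_support⟩ ⟨r, q.end_mem_support⟩
  rw [hG _ hS] at hcl
  change c.length = G.dist y r at hcl
  rw [SimpleGraph.dist_comm, hy] at hcl
  cases c with
  | nil => simp at hcl
  | @cons _ u _ h c' =>
    have hu : G.dist r u ≤ G.dist r g := by
      have h1 : G.dist u r ≤ (c'.map (SimpleGraph.Embedding.induce _).toHom).length :=
        SimpleGraph.dist_le _
      rw [SimpleGraph.Walk.length_map] at h1
      rw [SimpleGraph.Walk.length_cons] at hcl
      rw [SimpleGraph.dist_comm]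
      omega
    have hyu : G.Adj y u := h
    have hmem : (u : W) ∈ q.support := u.2
    have hmem := (SimpleGraph.Walk.mem_support_append_iff _ _).1 hmem
    rw [SimpleGraph.Walk.support_cons, List.mem_cons] at hmem
    rcases hmem with hm | hm | hm
    · exact absurd (hw _ hm) (by omega)
    · exact absurd (hw x w.end_mem_support) (by rw [← hm]; omega)
    · by_cases hug : (u : W) = g
      · rwa [hug] at hyu
      · exfalso
        have h1 := p.take_spec hm
        have h2 := congrArg SimpleGraph.Walk.length h1
        rw [SimpleGraph.Walk.length_append, hp] at h2
        have h3 : G.dist u r ≤ (p.dropUntil _ hm).length := SimpleGraph.dist_le _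
        have h4 : (p.takeUntil _ hm).length ≠ 0 := fun h0 =>
          hug (SimpleGraph.Walk.eq_of_length_eq_zero h0).symm
        have h5 : G.dist r y ≤ G.dist r u + G.dist (u : W) y := hc.dist_triangle
        have h6 : G.dist (u : W) y ≤ 1 := SimpleGraph.dist_le (.cons hyu.symm .nil)
        rw [SimpleGraph.dist_comm (u := g)] at h2
        rw [SimpleGraph.dist_comm (v := r)] at h3
        omega

end DistanceHereditary

/-! ### Join trees -/

namespace SimpleGraph

variable {E : Type*}

/-- Exchanging an edge of the path between two vertices of a tree for the edge that joins them. -/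
theorem IsTree.exchange [Finite E] {T : SimpleGraph E} (hT : T.IsTree) {e f x y : E}
    (p : T.Walk e f) (hp : p.IsPath) (hxy : s(x, y) ∈ p.edges) (hef : ¬ T.Adj e f) (hne : e ≠ f) :
    ∃ T' : SimpleGraph E, T'.IsTree ∧ T'.edgeSet = insert s(e, f) (T.edgeSet \ {s(x, y)}) := by
  classical
  have hle : T ≤ T ⊔ edge e f := le_sup_left
  have hfe : (T ⊔ edge e f).Adj f e := by
    rw [sup_adj, edge_adj]; exact .inr ⟨.inr ⟨rfl, rfl⟩, hne.symm⟩
  have hfeT : s(f, e) ∉ T.edgeSet := fun h => hef (T.adj_symm h)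
  have hxyT : s(x, y) ∈ T.edgeSet := p.edges_subset_edgeSet hxy
  -- The new edge closes `p` to a cycle through `s(x, y)`, which is thus no bridge; deleting it
  -- preserves connectedness and restores the edge count of a tree.
  have hcyc : (Walk.cons hfe (p.mapLe hle)).IsCycle := by
    rw [Walk.cons_isCycle_iff]
    refine ⟨(Walk.isPath_mapLe hle).2 hp, fun h => hfeT ?_⟩
    rw [Walk.edges_mapLe_eq_edges] at h
    exact p.edges_subset_edgeSet h
  have hbr : ¬ (T ⊔ edge e f).IsBridge s(x, y) := fun h =>
    (isBridge_iff_forall_cycle_notMem (edgeSet_mono hle hxyT)).1 h _ hcyc (by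
      rw [Walk.edges_cons, Walk.edges_mapLe_eq_edges]; exact List.mem_cons_of_mem _ hxy)
  have hconn := (hT.connected.mono hle).connected_delete_edge_of_not_isBridge hbr
  have hset : ((T ⊔ edge e f).deleteEdges {s(x, y)}).edgeSet =
      insert s(e, f) (T.edgeSet \ {s(x, y)}) := by
    rw [edgeSet_deleteEdges, edgeSet_sup, edgeSet_edge_of_ne hne, Set.union_singleton,
      Set.insert_sdiff_of_notMem]
    rintro (h : s(e, f) = s(x, y))
    rw [← h] at hxyT
    exact hef hxyT
  refine ⟨_, ?_, hset⟩
  rw [isTree_iff_connected_and_card]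
  refine ⟨hconn, ?_⟩
  rw [hset, ← (isTree_iff_connected_and_card.1 hT).2, Nat.card_coe_set_eq, Nat.card_coe_set_eq,
    Set.ncard_exchange (s := T.edgeSet) (fun h => hef h) hxyT]

end SimpleGraph

/-! ### Maximum weight trees and the union join graph -/

namespace FamHypergraph

variable {V E : Type*} {H : FamHypergraph V E}

/-- A walk on hyperedges whose steps pass through vertices of `A` lifts to the incidence graph. -/
theorem exists_incidenceGraph_walk {T : SimpleGraph E} (A : Set V) {e f : E} (p : T.Walk e f)
    (hp : ∀ d ∈ p.darts, (H.edge d.fst ∩ H.edge d.snd ∩ A).Nonempty) :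
    ∃ w : H.incidenceGraph.Walk (Sum.inr e) (Sum.inr f), ∀ x, Sum.inl x ∈ w.support → x ∈ A := by
  induction p with
  | nil => exact ⟨.nil, by simp⟩
  | @cons a b c h p ih =>
    obtain ⟨w, hw⟩ := ih fun d hd => hp d (by simp [hd])
    obtain ⟨x, ⟨hxa, hxb⟩, hxA⟩ := hp ⟨(a, b), h⟩ (by simp)
    have h1 : H.incidenceGraph.Adj (Sum.inr a) (Sum.inl x) := hxa
    have h2 : H.incidenceGraph.Adj (Sum.inl x) (Sum.inr b) := hxb
    refine ⟨.cons h1 (.cons h2 w), fun y hy => ?_⟩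
    simp only [SimpleGraph.Walk.support_cons, List.mem_cons, reduceCtorEq, Sum.inl.injEq,
      false_or] at hy
    rcases hy with rfl | hy
    · exact hxA
    · exact hw y hy

/-- In a γ-acyclic hypergraph, some step of every walk on hyperedges with the intersections of
consecutive hyperedges not properly contained in the intersection of the ends attains it. -/
theorem IsGammaAcyclic.exists_dart (hH : H.IsGammaAcyclic) {T : SimpleGraph E} {e f : E}
    (hne : e ≠ f) (hef : (H.edge e ∩ H.edge f).Nonempty) (p : T.Walk e f)
    (hp : ∀ d ∈ p.darts, H.edge d.fst ∩ H.edge d.snd ⊆ H.edge e ∩ H.edge f →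
      H.edge d.fst ∩ H.edge d.snd = H.edge e ∩ H.edge f) :
    ∃ d ∈ p.darts, H.edge d.fst ∩ H.edge d.snd = H.edge e ∩ H.edge f := by
  -- Otherwise every step has a vertex outside the intersection of the ends, and the lifted walk
  -- avoids all their common neighbours.
  by_contra! hcon
  obtain ⟨w, hw⟩ := exists_incidenceGraph_walk (H := H) (H.edge e ∩ H.edge f)ᶜ p fun d hd => by
    by_contra hemp
    refine hcon d hd (hp d hd fun x hx => ?_)
    by_contra hx'
    exact hemp ⟨x, hx, hx'⟩
  obtain ⟨z, hze, hzf⟩ := hef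
  obtain ⟨u, hu, hu1, hu2⟩ := IsDistanceHereditary.exists_common_neighbor hH
    (x := Sum.inr e) (y := Sum.inr f) (z := Sum.inl z) (by simpa using hne) (fun h => h) hze hzf w
  cases u with
  | inl x => exact hw x hu ⟨hu1, hu2⟩
  | inr g => exact hu1

/-- The weight of a pair of hyperedges is the size of their intersection. -/
noncomputable def interWeight (H : FamHypergraph V E) : Sym2 E → ℕ :=
  Sym2.lift ⟨fun e f => (H.edge e ∩ H.edge f).ncard, fun e f => by simp only [Set.inter_comm]⟩

/-- The weight of a graph on the hyperedges. -/
noncomputable def graphWeight (H : FamHypergraph V E) (T : SimpleGraph E) : ℕ :=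
  ∑ᶠ z ∈ T.edgeSet, H.interWeight z

/-- A tree on the hyperedges that has the maximum weight. -/
def IsMaxTree (H : FamHypergraph V E) (T : SimpleGraph E) : Prop :=
  T.IsTree ∧ ∀ T' : SimpleGraph E, T'.IsTree → H.graphWeight T' ≤ H.graphWeight T

theorem exists_isMaxTree [Finite E] [Nonempty E] (H : FamHypergraph V E) :
    ∃ T, H.IsMaxTree T := by
  obtain ⟨T₀, -, hT₀⟩ := (SimpleGraph.connected_top (V := E)).exists_isTree_le
  obtain ⟨T, hT, hmax⟩ := Set.exists_max_image {T : SimpleGraph E | T.IsTree} H.graphWeight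
    (Set.toFinite _) ⟨T₀, hT₀⟩
  exact ⟨T, hT, hmax⟩

/-- The exchange changes the weight by the difference of the two intersection sizes. Maximality
makes this at most zero, and equal intersections leave the weight maximal. -/
theorem IsMaxTree.exchange [Finite E] {T : SimpleGraph E} (hT : H.IsMaxTree T) {e f : E}
    (hne : e ≠ f) (hef : ¬ T.Adj e f) (p : T.Walk e f) (hp : p.IsPath) {x y : E}
    (hxy : s(x, y) ∈ p.edges) :
    (H.edge e ∩ H.edge f).ncard ≤ (H.edge x ∩ H.edge y).ncard ∧
    (H.edge x ∩ H.edge y = H.edge e ∩ H.edge f → ∃ T', H.IsMaxTree T' ∧ T'.Adj e f) := by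
  obtain ⟨T', hT', hset⟩ := hT.1.exchange p hp hxy hef hne
  have hxyT : s(x, y) ∈ T.edgeSet := p.edges_subset_edgeSet hxy
  have h1 : H.graphWeight T = H.interWeight s(x, y) +
      ∑ᶠ z ∈ T.edgeSet \ {s(x, y)}, H.interWeight z := by
    rw [graphWeight, ← finsum_mem_insert _ (by simp) (Set.toFinite _), Set.insert_sdiff_singleton,
      Set.insert_eq_of_mem hxyT]
  have h2 : H.graphWeight T' = H.interWeight s(e, f) +
      ∑ᶠ z ∈ T.edgeSet \ {s(x, y)}, H.interWeight z := by
    rw [graphWeight, hset, finsum_mem_insert _ (fun h => hef h.1) (Set.toFinite _)]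
  have h3 := hT.2 T' hT'
  have h4 : H.interWeight s(x, y) = (H.edge x ∩ H.edge y).ncard := rfl
  have h5 : H.interWeight s(e, f) = (H.edge e ∩ H.edge f).ncard := rfl
  refine ⟨by omega, fun heq => ⟨T', ⟨hT', fun T'' hT'' => ?_⟩, ?_⟩⟩
  · have := hT.2 T'' hT''
    rw [heq] at h4
    omega
  · rw [← SimpleGraph.mem_edgeSet, hset]
    exact Set.mem_insert _ _

/-- Intersecting hyperedges have the same intersection as some consecutive hyperedges on the path
between them in a maximum weight tree. -/
theorem IsMaxTree.exists_dart [Finite V] [Finite E] (hH : H.IsGammaAcyclic) {T : SimpleGraph E}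
    (hT : H.IsMaxTree T) {e f : E} (hne : e ≠ f) (hef : (H.edge e ∩ H.edge f).Nonempty)
    (hadj : ¬ T.Adj e f) (p : T.Walk e f) (hp : p.IsPath) :
    ∃ d ∈ p.darts, H.edge d.fst ∩ H.edge d.snd = H.edge e ∩ H.edge f :=
  hH.exists_dart hne hef p fun d hd hsub => by
    have hd' : s(d.fst, d.snd) ∈ p.edges := List.mem_map.2 ⟨d, hd, rfl⟩
    exact Set.eq_of_subset_of_ncard_le hsub (hT.exchange hne hadj p hp hd').1 (Set.toFinite _)

/-- Some step of the path has the intersection of its ends, so both hyperedges of that step contain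
`v`, and the two remaining pieces are shorter. The bound `k` lets the induction vary the ends. -/
theorem IsMaxTree.mem_of_mem_support [Finite V] [Finite E] (hH : H.IsGammaAcyclic)
    {T : SimpleGraph E} (hT : H.IsMaxTree T) {v : V} (k : ℕ) :
    ∀ {e f : E} (p : T.Walk e f), p.IsPath → p.length ≤ k → v ∈ H.edge e → v ∈ H.edge f →
      ∀ g ∈ p.support, v ∈ H.edge g := by
  classical
  induction k with
  | zero =>
    intro e f p _ hk he _ g hg
    cases p with
    | nil => simp only [SimpleGraph.Walk.support_nil, List.mem_singleton] at hg; rwa [hg]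
    | cons => simp at hk
  | succ k ih =>
    intro e f p hp hk he hf g hg
    by_cases hne : e = f
    · subst hne
      rw [SimpleGraph.Walk.eq_nil_iff_nil.2 (SimpleGraph.Walk.isPath_iff_nil.1 hp)] at hg
      simp only [SimpleGraph.Walk.support_nil, List.mem_singleton] at hg; rwa [hg]
    by_cases hadj : T.Adj e f
    · have : p = hadj.toWalk := congrArg Subtype.val
        ((hT.1.isAcyclic.subsingleton_path e f).elim ⟨p, hp⟩ ⟨hadj.toWalk, by simpa using hne⟩)
      rw [this] at hg
      simp only [SimpleGraph.Walk.support_cons, SimpleGraph.Walk.support_nil, List.mem_cons,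
        List.not_mem_nil, or_false] at hg
      rcases hg with rfl | rfl <;> assumption
    obtain ⟨d, hd, hdeq⟩ := hT.exists_dart hH hne ⟨v, he, hf⟩ hadj p hp
    have hvd : v ∈ H.edge d.fst ∩ H.edge d.snd := by rw [hdeq]; exact ⟨he, hf⟩
    obtain ⟨p₁, p₂, rfl⟩ := (SimpleGraph.Walk.isSubwalk_toWalk_adj_iff_mem_darts p).2 hd
    have h₁ := hp.of_append_left.of_append_left
    have h₂ := hp.of_append_right
    simp only [SimpleGraph.Walk.length_append, SimpleGraph.Walk.length_cons] at hk
    rw [SimpleGraph.Walk.mem_support_append_iff, SimpleGraph.Walk.mem_support_append_iff] at hg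
    rcases hg with (hg | hg) | hg
    · exact ih p₁ h₁ (by omega) he hvd.1 g hg
    · simp only [SimpleGraph.Walk.support_cons, SimpleGraph.Walk.support_nil, List.mem_cons,
        List.not_mem_nil, or_false] at hg
      rcases hg with rfl | rfl
      exacts [hvd.1, hvd.2]
    · exact ih p₂ h₂ (by omega) hvd.2 hf g hg

theorem IsMaxTree.isJoinTree [Finite V] [Finite E] (hH : H.IsGammaAcyclic)
    {T : SimpleGraph E} (hT : H.IsMaxTree T) : H.IsJoinTree T := by
  refine ⟨hT.1, fun v e f => ?_⟩
  obtain ⟨p, hp⟩ := (hT.1.connected.preconnected e f).exists_isPath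
  exact ⟨p.induce _ (hT.mem_of_mem_support hH _ p hp le_rfl e.2 f.2)⟩

/-- The ends of an edge of a join tree intersect if the incidence graph is connected. -/
theorem IsJoinTree.inter_nonempty (hc : H.incidenceGraph.Connected) {T : SimpleGraph E}
    (hT : H.IsJoinTree T) {e f : E} (hef : T.Adj e f) : (H.edge e ∩ H.edge f).Nonempty := by
  by_contra hemp
  have hbr : ¬ (T.deleteEdges {s(e, f)}).Reachable e f := by
    have := SimpleGraph.isAcyclic_iff_forall_isBridge.1 hT.1.isAcyclic
      (T.mem_edgeSet.2 hef)
    exact SimpleGraph.isBridge_iff.1 this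
  -- No vertex lies in both `e` and `f`, so the subtree of each vertex survives the deletion of this
  -- edge.
  have hstep : ∀ v g g', v ∈ H.edge g → v ∈ H.edge g' →
      (T.deleteEdges {s(e, f)}).Reachable g g' := by
    intro v g g' hg hg'
    obtain ⟨w⟩ := hT.2 v ⟨g, hg⟩ ⟨g', hg'⟩
    refine SimpleGraph.Reachable.map (G := T.induce {e | v ∈ H.edge e}) ⟨Subtype.val, ?_⟩ ⟨w⟩
    intro a b hab
    rw [SimpleGraph.deleteEdges_adj]
    refine ⟨hab, fun heq => hemp ?_⟩
    rcases Sym2.eq_iff.1 (Set.mem_singleton_iff.1 heq) with ⟨h1, h2⟩ | ⟨h1, h2⟩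
    · exact ⟨v, h1 ▸ a.2, h2 ▸ b.2⟩
    · exact ⟨v, h2 ▸ b.2, h1 ▸ a.2⟩
  -- Along a walk in the incidence graph, a vertex is represented by any hyperedge containing it, so
  -- that the component of the hyperedges never changes.
  have hall : ∀ {x y : V ⊕ E} (w : H.incidenceGraph.Walk x y) (g g' : E),
      (x = Sum.inr g ∨ ∃ v, x = Sum.inl v ∧ v ∈ H.edge g) → y = Sum.inr g' →
      (T.deleteEdges {s(e, f)}).Reachable g g' := by
    intro x y w
    induction w with
    | nil =>
      rintro g g' (rfl | ⟨v, rfl, -⟩) hg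
      · cases hg; exact .rfl
      · cases hg
    | @cons a b c hab w ih =>
      rintro g g' (rfl | ⟨v, rfl, hv⟩) hg
      · rcases b with v | g''
        · exact ih g g' (.inr ⟨v, rfl, hab⟩) hg
        · exact hab.elim
      · rcases b with v' | g''
        · exact hab.elim
        · exact (hstep v g g'' hv hab).trans (ih g'' g' (.inl rfl) hg)
  obtain ⟨w⟩ := hc.preconnected (Sum.inr e) (Sum.inr f)
  exact hbr (hall w e f (.inl rfl) rfl)

theorem lineGraph_eq_dual_twoSection (H : FamHypergraph V E) :
    H.lineGraph = H.dual.twoSection := rfl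

/-- The union join graph of a connected γ-acyclic hypergraph is its line graph. -/
theorem IsGammaAcyclic.unionJoinGraph_eq_lineGraph [Finite V] [Finite E] (hH : H.IsGammaAcyclic)
    (hc : H.incidenceGraph.Connected) : H.unionJoinGraph = H.lineGraph := by
  ext e f
  constructor
  · rintro ⟨T, hT, hef⟩
    exact ⟨hef.ne, hT.inter_nonempty hc hef⟩
  · rintro ⟨hne, hef⟩
    have : Nonempty E := ⟨e⟩
    obtain ⟨T, hT⟩ := H.exists_isMaxTree
    by_cases hadj : T.Adj e f
    · exact ⟨T, hT.isJoinTree hH, hadj⟩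
    obtain ⟨p, hp⟩ := (hT.1.connected.preconnected e f).exists_isPath
    obtain ⟨d, hd, hdeq⟩ := hT.exists_dart hH hne hef hadj p hp
    have hd' : s(d.fst, d.snd) ∈ p.edges := List.mem_map.2 ⟨d, hd, rfl⟩
    obtain ⟨T', hT', h⟩ := (hT.exchange hne hadj p hp hd').2 hdeq
    exact ⟨T', hT'.isJoinTree hH, h⟩

/-- Exchanging vertices and hyperedges is an isomorphism of incidence graphs. -/
def dualIncidenceIso (H : FamHypergraph V E) : H.dual.incidenceGraph ≃g H.incidenceGraph where
  toEquiv := Equiv.sumComm E V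
  map_rel_iff' := by rintro (a | a) (b | b) <;> exact Iff.rfl

end FamHypergraph

/-! ### Invariance under isomorphism, and the dual -/

theorem SimpleGraph.Iso.dist_le_of_reachable {W W' : Type*} {G : SimpleGraph W}
    {G' : SimpleGraph W'} (φ : G ≃g G') {x y : W} (h : G.Reachable x y) :
    G'.dist (φ x) (φ y) ≤ G.dist x y := by
  obtain ⟨p, hp⟩ := h.exists_walk_length_eq_dist
  rw [← hp, ← p.length_map φ.toHom]
  exact SimpleGraph.dist_le _

theorem SimpleGraph.Iso.dist_eq {W W' : Type*} {G : SimpleGraph W} {G' : SimpleGraph W'}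
    (φ : G ≃g G') (x y : W) : G'.dist (φ x) (φ y) = G.dist x y := by
  by_cases h : G.Reachable x y
  · refine le_antisymm (φ.dist_le_of_reachable h) ?_
    simpa using φ.symm.dist_le_of_reachable (φ.reachable_iff.2 h)
  · rw [SimpleGraph.dist_eq_zero_of_not_reachable h,
      SimpleGraph.dist_eq_zero_of_not_reachable fun h' => h (φ.reachable_iff.1 h')]

theorem IsDistanceHereditary.of_iso {W W' : Type*} {G : SimpleGraph W} {G' : SimpleGraph W'}
    (φ : G ≃g G') (h : IsDistanceHereditary G') : IsDistanceHereditary G := by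
  intro S hS x y
  let ψ : G.induce S ≃g G'.induce (φ '' S) :=
    { toEquiv := φ.toEquiv.image S
      map_rel_iff' := φ.map_rel_iff }
  have := h _ (ψ.connected_iff.1 hS) (ψ x) (ψ y)
  rw [ψ.dist_eq] at this
  rw [this]
  exact φ.dist_eq x y

theorem FamHypergraph.IsGammaAcyclic.dual {V E : Type*} {H : FamHypergraph V E}
    (hH : H.IsGammaAcyclic) : H.dual.IsGammaAcyclic :=
  IsDistanceHereditary.of_iso H.dualIncidenceIso hH

/-! ### Breadth-first levels in γ-acyclic hypergraphs -/

/-- A function that changes by at most one along edges and decreases along some edge at every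
vertex other than `r` is the distance from `r`. -/
theorem SimpleGraph.Connected.dist_eq_of_levels {W : Type*} {G : SimpleGraph W} (hc : G.Connected)
    {r : W} {l : W → ℕ} (h0 : l r = 0) (hle : ∀ x y, G.Adj x y → l y ≤ l x + 1)
    (hdec : ∀ x, x ≠ r → ∃ y, G.Adj x y ∧ l x = l y + 1) (x : W) : G.dist r x = l x := by
  apply le_antisymm
  · have key : ∀ (k : ℕ) (x : W), l x = k → G.dist r x ≤ k := by
      intro k
      induction k with
      | zero =>
        intro x hx
        by_cases hxr : x = r
        · simp [hxr]
        · obtain ⟨y, -, hy⟩ := hdec x hxr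
          omega
      | succ k ih =>
        intro x hx
        have hxr : x ≠ r := by rintro rfl; omega
        obtain ⟨y, hxy, hy⟩ := hdec x hxr
        have h1 := ih y (by omega)
        have h2 : G.dist r x ≤ G.dist r y + G.dist y x := hc.dist_triangle
        have h3 : G.dist y x ≤ 1 := SimpleGraph.dist_le (.cons hxy.symm .nil)
        omega
    exact key _ x rfl
  · obtain ⟨p, hp⟩ := hc.exists_walk_length_eq_dist r x
    have key : ∀ {a b : W} (p : G.Walk a b), l b ≤ l a + p.length := by
      intro a b p
      induction p with
      | nil => simp
      | @cons a b c hab p ih =>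
        have := hle a b hab
        rw [SimpleGraph.Walk.length_cons]
        omega
    have := key p
    omega

namespace FamHypergraph

variable {V E : Type*} {H : FamHypergraph V E} {r : E} {lev : E → ℕ} {levV : V → ℕ}

/-- Breadth-first levels from the hyperedge `r`: a hyperedge `e` has distance `2 * lev e - 2` and a
vertex `v` has distance `2 * levV v - 1` from `r`. -/
structure IsLevelling (H : FamHypergraph V E) (r : E) (lev : E → ℕ) (levV : V → ℕ) : Prop where
  root : lev r = 1
  pos : ∀ e, 1 ≤ lev e
  le : ∀ v e, v ∈ H.edge e → levV v ≤ lev e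
  le_succ : ∀ v e, v ∈ H.edge e → lev e ≤ levV v + 1
  exists_eq : ∀ v, ∃ e, v ∈ H.edge e ∧ lev e = levV v
  exists_lt : ∀ e, e ≠ r → ∃ v, v ∈ H.edge e ∧ lev e = levV v + 1

/-- The vertices of a hyperedge that are closer to the root. -/
def down (H : FamHypergraph V E) (lev : E → ℕ) (levV : V → ℕ) (e : E) : Set V :=
  {v | v ∈ H.edge e ∧ levV v < lev e}

namespace IsLevelling

theorem levV_pos (h : H.IsLevelling r lev levV) (v : V) : 1 ≤ levV v := by
  obtain ⟨e, -, he⟩ := h.exists_eq v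
  rw [← he]
  exact h.pos e

/-- Hyperedges have even and vertices odd distance from the root. Levels start at 1 because the
search uses 0 for "unvisited". -/
theorem dist_eq (h : H.IsLevelling r lev levV) (hc : H.incidenceGraph.Connected) (x : V ⊕ E) :
    H.incidenceGraph.dist (Sum.inr r) x =
      Sum.elim (fun v => 2 * levV v - 1) (fun e => 2 * (lev e - 1)) x := by
  refine hc.dist_eq_of_levels ?_ ?_ ?_ x
  · simp [h.root]
  · rintro (v | e) (w | f) hxy
    · exact hxy.elim
    · have := h.le_succ v f hxy
      have := h.levV_pos v
      simp only [Sum.elim_inl, Sum.elim_inr]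
      omega
    · have := h.le w e hxy
      simp only [Sum.elim_inl, Sum.elim_inr]
      omega
    · exact hxy.elim
  · rintro (v | e) hx
    · obtain ⟨e, hv, he⟩ := h.exists_eq v
      have := h.levV_pos v
      refine ⟨Sum.inr e, hv, ?_⟩
      simp only [Sum.elim_inl, Sum.elim_inr]
      omega
    · have hne : e ≠ r := fun h' => hx (h' ▸ rfl)
      obtain ⟨v, hv, he⟩ := h.exists_lt e hne
      have := h.levV_pos v
      refine ⟨Sum.inl v, hv, ?_⟩
      simp only [Sum.elim_inl, Sum.elim_inr]
      omega

theorem dist_inr (h : H.IsLevelling r lev levV) (hc : H.incidenceGraph.Connected) (e : E) :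
    H.incidenceGraph.dist (Sum.inr r) (Sum.inr e) = 2 * (lev e - 1) := h.dist_eq hc _

theorem dist_inl (h : H.IsLevelling r lev levV) (hc : H.incidenceGraph.Connected) (v : V) :
    H.incidenceGraph.dist (Sum.inr r) (Sum.inl v) = 2 * levV v - 1 := h.dist_eq hc _

/-- The walk `f`, `v`, `e` stays farther from the root than `u`, so `adj_of_adj_of_walk` passes the
neighbour `u` from `e` to `f`. -/
theorem mem_of_common_upper (h : H.IsLevelling r lev levV) (hc : H.incidenceGraph.Connected)
    (hH : H.IsGammaAcyclic) {e f : E} {u v : V} (hve : v ∈ H.edge e) (hvf : v ∈ H.edge f)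
    (he : lev e = levV v) (hf : lev f = levV v) (hu : u ∈ H.edge e) (hul : levV u < lev e) :
    u ∈ H.edge f := by
  have h1 : H.incidenceGraph.Adj (Sum.inr f) (Sum.inl v) := hvf
  have h2 : H.incidenceGraph.Adj (Sum.inl v) (Sum.inr e) := hve
  have hu1 := h.le_succ u e hu
  have hu0 := h.levV_pos u
  refine IsDistanceHereditary.adj_of_adj_of_walk hH hc (r := Sum.inr r) (x := Sum.inr e)
    (y := Sum.inr f) (g := Sum.inl u) hu ?_ (.cons h1 (.cons h2 .nil)) ?_
  · rw [h.dist_inr hc, h.dist_inl hc]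
    omega
  · intro z hz
    simp only [SimpleGraph.Walk.support_cons, SimpleGraph.Walk.support_nil, List.mem_cons,
      List.not_mem_nil, or_false] at hz
    rcases hz with rfl | rfl | rfl <;> simp only [h.dist_inr hc, h.dist_inl hc] <;> omega

/-- The same argument with vertices and hyperedges exchanged: the walk `v`, `e`, `u` stays farther
from the root than `g`. -/
theorem mem_of_common_lower (h : H.IsLevelling r lev levV) (hc : H.incidenceGraph.Connected)
    (hH : H.IsGammaAcyclic) {e g : E} {u v : V} (hue : u ∈ H.edge e) (hve : v ∈ H.edge e)
    (hu : levV u < lev e) (hv : levV v < lev e) (hug : u ∈ H.edge g) (hg : lev g = levV u) :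
    v ∈ H.edge g := by
  have h1 : H.incidenceGraph.Adj (Sum.inl v) (Sum.inr e) := hve
  have h2 : H.incidenceGraph.Adj (Sum.inr e) (Sum.inl u) := hue
  have hu1 := h.le_succ u e hue
  have hv1 := h.le_succ v e hve
  have hu0 := h.levV_pos u
  refine IsDistanceHereditary.adj_of_adj_of_walk hH hc (r := Sum.inr r) (x := Sum.inl u)
    (y := Sum.inl v) (g := Sum.inr g) hug ?_ (.cons h1 (.cons h2 .nil)) ?_
  · rw [h.dist_inr hc, h.dist_inl hc]
    omega
  · intro z hz
    simp only [SimpleGraph.Walk.support_cons, SimpleGraph.Walk.support_nil, List.mem_cons,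
      List.not_mem_nil, or_false] at hz
    rcases hz with rfl | rfl | rfl <;> simp only [h.dist_inr hc, h.dist_inl hc] <;> omega

/-- If `a` and `b` witness that neither set contains the other, a hyperedge `g` at `v` one level up
contains both. The walk `e`, `a`, `g`, `b`, `f` then meets no common neighbour of `e` and `f`,
although `v` is one. -/
theorem down_nested (h : H.IsLevelling r lev levV) (hc : H.incidenceGraph.Connected)
    (hH : H.IsGammaAcyclic) {e f : E} {v : V} (hne : e ≠ f) (hve : v ∈ H.down lev levV e)
    (hvf : v ∈ H.down lev levV f) (hef : lev e = lev f) :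
    H.down lev levV e ⊆ H.down lev levV f ∨ H.down lev levV f ⊆ H.down lev levV e := by
  by_contra! hcon
  obtain ⟨⟨a, hae, haf⟩, ⟨b, hbf, hbe⟩⟩ := And.imp Set.not_subset.1 Set.not_subset.1 hcon
  have haf' : a ∉ H.edge f := fun h' => haf ⟨h', hef ▸ hae.2⟩
  have hbe' : b ∉ H.edge e := fun h' => hbe ⟨h', hef ▸ hbf.2⟩
  obtain ⟨g, hvg, hg⟩ := h.exists_eq v
  have hag := h.mem_of_common_lower hc hH hve.1 hae.1 hve.2 hae.2 hvg hg
  have hbg := h.mem_of_common_lower hc hH hvf.1 hbf.1 hvf.2 hbf.2 hvg hg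
  have h1 : H.incidenceGraph.Adj (Sum.inr e) (Sum.inl a) := hae.1
  have h2 : H.incidenceGraph.Adj (Sum.inl a) (Sum.inr g) := hag
  have h3 : H.incidenceGraph.Adj (Sum.inr g) (Sum.inl b) := hbg
  have h4 : H.incidenceGraph.Adj (Sum.inl b) (Sum.inr f) := hbf.1
  obtain ⟨u, hu, hue, huf⟩ := IsDistanceHereditary.exists_common_neighbor hH
    (x := Sum.inr e) (y := Sum.inr f) (z := Sum.inl v) (by simpa using hne) (fun h => h)
    hve.1 hvf.1 (.cons h1 (.cons h2 (.cons h3 (.cons h4 .nil))))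
  simp only [SimpleGraph.Walk.support_cons, SimpleGraph.Walk.support_nil, List.mem_cons,
    List.not_mem_nil, or_false] at hu
  rcases hu with rfl | rfl | rfl | rfl | rfl
  · exact hue
  · exact haf' huf
  · exact hue
  · exact hbe' hue
  · exact huf

/-- If two hyperedges intersect, the one that is later in the order by level and by decreasing
size of `down` has its down-vertices in the other. -/
theorem down_mem_of_inter [Finite V] (h : H.IsLevelling r lev levV)
    (hc : H.incidenceGraph.Connected) (hH : H.IsGammaAcyclic) {e f : E} {p : V} (hne : e ≠ f)
    (hp : p ∈ H.edge e) (hpl : levV p < lev e) (hef : (H.edge e ∩ H.edge f).Nonempty)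
    (hlt : lev f < lev e ∨ lev f = lev e ∧
      (H.down lev levV e).ncard ≤ (H.down lev levV f).ncard) :
    p ∈ H.edge f := by
  obtain ⟨v, hve, hvf⟩ := hef
  have := h.le_succ p e hp
  have := h.le v e hve
  have := h.le_succ v e hve
  have := h.le v f hvf
  have := h.le_succ v f hvf
  -- On different levels, `lev f = levV v = lev e - 1`. On the same level, a common vertex `v`
  -- either has that level too, or lies below both; then the down-sets are nested and their sizes
  -- decide the direction.
  rcases hlt with hlt | ⟨heq, hcard⟩
  · exact h.mem_of_common_lower hc hH hve hp (by omega) (by omega) hvf (by omega)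
  · by_cases hv : levV v = lev e
    · exact h.mem_of_common_upper hc hH hve hvf hv.symm (by omega) hp hpl
    · have hsub : H.down lev levV e ⊆ H.down lev levV f := by
        rcases h.down_nested hc hH hne ⟨hve, by omega⟩ ⟨hvf, by omega⟩ heq.symm with hs | hs
        · exact hs
        · exact (Set.eq_of_subset_of_ncard_le hs hcard (Set.toFinite _)).symm.subset
      exact (hsub ⟨hp, by omega⟩).1

end IsLevelling

end FamHypergraph

/-! ### Rules for running time with credits -/

namespace RAM

namespace Memory

variable (s : Memory) (x y v a b i : ℕ)

@[simp] theorem setReg_reg : (s.setReg x v).reg y = if y = x then v else s.reg y := by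
  simp [setReg, Function.update_apply]

@[simp] theorem setReg_arr : (s.setReg x v).arr = s.arr := rfl

@[simp] theorem setArr_reg : (s.setArr a i v).reg = s.reg := rfl

@[simp] theorem setArr_arr : (s.setArr a i v).arr b =
    if b = a then Function.update (s.arr a) i v else s.arr b := by
  simp [setArr, Function.update_apply]

end Memory

attribute [simp] Op.apply Cond.Holds

/-- Started in `s` with `φ` credits, the program halts, paying one credit for each step, and the
remaining credits and the final memory satisfy `Q`. -/
def Runs (p : Program) (s : Memory) (φ : ℕ) (Q : ℕ → Memory → Prop) : Prop :=
  ∃ t s' ψ, Exec p s t s' ∧ t + ψ ≤ φ ∧ Q ψ s'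

/-- Execute a list of elementary operations. -/
def block : List Op → Program
  | [] => .skip
  | o :: os => .seq (.op o) (block os)

variable {p q : Program} {s : Memory} {φ : ℕ} {b : Cond} {Q R : ℕ → Memory → Prop}

theorem Runs.mono (h : Runs p s φ Q) (hQ : ∀ ψ s', Q ψ s' → R ψ s') : Runs p s φ R := by
  obtain ⟨t, s', ψ, he, hle, hq⟩ := h
  exact ⟨t, s', ψ, he, hle, hQ _ _ hq⟩

/-- What the second program needs is the postcondition of the first, credits included; correctness
and time are thus proved together. -/
theorem Runs.seq (h : Runs p s φ fun ψ s' => Runs q s' ψ Q) : Runs (.seq p q) s φ Q := by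
  obtain ⟨t, s', ψ, he, hle, t', s'', ψ', he', hle', hq⟩ := h
  exact ⟨t + t', s'', ψ', .seq he he', by omega, hq⟩

theorem Runs.skip (hφ : 1 ≤ φ) (h : Q (φ - 1) s) : Runs .skip s φ Q :=
  ⟨1, s, φ - 1, .skip s, by omega, h⟩

theorem Runs.block (os : List Op) (hφ : os.length + 1 ≤ φ)
    (h : Q (φ - (os.length + 1)) (os.foldl (fun s o => o.apply s) s)) :
    Runs (RAM.block os) s φ Q := by
  refine ⟨os.length + 1, _, _, ?_, by omega, h⟩
  clear h hφ
  induction os generalizing s with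
  | nil => exact .skip s
  | cons o os ih =>
    rw [List.length_cons, Nat.add_comm _ 1]
    exact .seq (.op o s) ih

theorem Runs.ite (hφ : 1 ≤ φ) (h₁ : b.Holds s → Runs p s (φ - 1) Q)
    (h₂ : ¬ b.Holds s → Runs q s (φ - 1) Q) : Runs (.ite b p q) s φ Q := by
  by_cases hb : b.Holds s
  · obtain ⟨t, s', ψ, he, hle, hq⟩ := h₁ hb
    exact ⟨t + 1, s', ψ, .iteTrue hb he, by omega, hq⟩
  · obtain ⟨t, s', ψ, he, hle, hq⟩ := h₂ hb
    exact ⟨t + 1, s', ψ, .iteFalse hb he, by omega, hq⟩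

/-- A loop with an invariant that guarantees enough credits. -/
theorem Runs.loop (Inv : ℕ → Memory → Prop) (hs : Inv φ s)
    (hdone : ∀ φ s, Inv φ s → ¬ b.Holds s → 1 ≤ φ ∧ Q (φ - 1) s)
    (hstep : ∀ φ s, Inv φ s → b.Holds s → 1 ≤ φ ∧ Runs p s (φ - 1) Inv) :
    Runs (.loop b p) s φ Q := by
  -- Each test costs a credit, so the credits themselves prove termination.
  induction φ using Nat.strong_induction_on generalizing s with
  | _ φ ih =>
    by_cases hb : b.Holds s
    · obtain ⟨h1, t, s', ψ, he, hle, hq⟩ := hstep φ s hs hb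
      obtain ⟨t', s'', ψ', he', hle', hq'⟩ := ih ψ (by omega) hq
      exact ⟨t + t' + 1, s'', ψ', .loopStep hb he he', by omega, hq'⟩
    · obtain ⟨h1, h2⟩ := hdone φ s hs hb
      exact ⟨1, s, φ - 1, .loopDone hb, by omega, h2⟩

/-! ### Linked lists in arrays -/

/-- Starting at the pointer `i`, the pointers `next` lead through cells with the contents `l`; the
pointer `k + 1` points to cell `k`, and `0` is the null pointer. -/
inductive Chain (next val : ℕ → ℕ) : ℕ → List ℕ → Prop
  | nil : Chain next val 0 []
  | cons {k : ℕ} {l : List ℕ} : Chain next val (next k) l → Chain next val (k + 1) (val k :: l)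

theorem Chain.pos_iff {next val : ℕ → ℕ} {i : ℕ} {l : List ℕ} (h : Chain next val i l) :
    0 < i ↔ l ≠ [] := by
  cases h <;> simp

theorem Chain.exists_of_pos {next val : ℕ → ℕ} {i : ℕ} {l : List ℕ} (h : Chain next val i l)
    (hi : 0 < i) : ∃ l', l = val (i - 1) :: l' ∧ Chain next val (next (i - 1)) l' := by
  cases h with
  | nil => omega
  | cons h => exact ⟨_, rfl, h⟩

/-- Pointers lead only to earlier cells, so a chain starting at or below `K` never reads cell `K`,
which may be overwritten. -/
theorem Chain.congr {next next' val : ℕ → ℕ} {i K : ℕ} {l : List ℕ} (hi : i ≤ K)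
    (hlt : ∀ k < K, next' k = next k ∧ next k ≤ k) (h : Chain next val i l) :
    Chain next' val i l := by
  induction h with
  | nil => exact .nil
  | @cons k l _ ih =>
    have := hlt k (by omega)
    refine .cons ?_
    rw [this.1]
    exact ih (by omega)

/-- The values with indices less than `K` whose key is `i`, the last one first. -/
def bucket (key val : ℕ → ℕ) (K i : ℕ) : List ℕ :=
  (((List.range K).filter fun k => key k = i).reverse).map val

theorem mem_bucket {key val : ℕ → ℕ} {K i x : ℕ} :
    x ∈ bucket key val K i ↔ ∃ k < K, key k = i ∧ val k = x := by
  simp [bucket, and_assoc]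

theorem bucket_succ (key val : ℕ → ℕ) (K i : ℕ) : bucket key val (K + 1) i =
    if key K = i then val K :: bucket key val K i else bucket key val K i := by
  by_cases h : key K = i <;> simp [bucket, List.range_succ, h]

theorem bucket_nodup {key val : ℕ → ℕ} {K i : ℕ}
    (h : ∀ j < K, ∀ k < K, key j = key k → val j = val k → j = k) :
    (bucket key val K i).Nodup := by
  refine List.Nodup.map_on ?_ (List.nodup_reverse.2 (List.nodup_range.filter _))
  intro j hj k hk hjk
  simp only [List.mem_reverse, List.mem_filter, List.mem_range, decide_eq_true_eq] at hj hk
  exact h j hj.1 k hk.1 (hj.2.trans hk.2.symm) hjk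

/-- This turns a cost per list cell, summed over all keys, into a cost linear in the number of
items. -/
theorem sum_length_bucket {key val : ℕ → ℕ} {K n : ℕ} (h : ∀ k < K, key k < n) :
    ∑ i ∈ Finset.range n, (bucket key val K i).length = K := by
  induction K with
  | zero => simp [bucket]
  | succ K ih =>
    have hK : key K ∈ Finset.range n := Finset.mem_range.2 (h K (by omega))
    have hs : ∀ i, (bucket key val (K + 1) i).length =
        (bucket key val K i).length + if key K = i then 1 else 0 := by
      intro i
      rw [bucket_succ]
      split <;> simp
    simp only [hs, Finset.sum_add_distrib, Finset.sum_ite_eq, hK, if_true]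
    rw [ih fun k hk => h k (by omega)]

/-- The arrays `head` and `next` hold the linked lists of the buckets of the first `K` items. -/
structure Buckets (key val : ℕ → ℕ) (K : ℕ) (head next : ℕ → ℕ) : Prop where
  head_le : ∀ i, head i ≤ K
  next_le : ∀ k < K, next k ≤ k
  chain : ∀ i, Chain next val (head i) (bucket key val K i)

theorem Buckets.zero (key val : ℕ → ℕ) : Buckets key val 0 (fun _ => 0) (fun _ => 0) :=
  ⟨fun _ => le_rfl, fun _ _ => Nat.zero_le _, fun _ => .nil⟩

theorem Buckets.succ {key val : ℕ → ℕ} {K : ℕ} {head next : ℕ → ℕ}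
    (h : Buckets key val K head next) :
    Buckets key val (K + 1) (Function.update head (key K) (K + 1))
      (Function.update next K (head (key K))) := by
  have hch : ∀ i, Chain (Function.update next K (head (key K))) val (head i)
      (bucket key val K i) := fun i => (h.chain i).congr (h.head_le i) fun k hk => by
    rw [Function.update_of_ne (by omega)]
    exact ⟨rfl, h.next_le k hk⟩
  refine ⟨fun i => ?_, fun k hk => ?_, fun i => ?_⟩
  · have := h.head_le i
    rw [Function.update_apply]
    split <;> omega
  · rw [Function.update_apply]
    split
    · subst k; exact h.head_le _
    · exact h.next_le k (by omega)
  · rw [bucket_succ, Function.update_apply]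
    by_cases hi : key K = i
    · subst hi
      rw [if_pos rfl, if_pos rfl]
      refine .cons ?_
      rw [Function.update_self]
      exact hch _
    · rw [if_neg hi, if_neg (fun h' => hi h'.symm)]
      exact hch i

end RAM

/-! ### The invariant of breadth-first search -/

namespace RAM

/-- The state of a breadth-first search on a hypergraph with vertices `< n`, hyperedges `< m` and
incidence relation `inc`.  The queue `q` has its front at `h` and its end at `t`, and the levels of
the hyperedges in it are `d` or `d + 1`; level `0` means unvisited.  The hyperedges in the queue or
unvisited belong to `R`, the unvisited vertices belong to `U`.  The vertices `PV` of the last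
removed hyperedge, and the incident pairs `PF`, may still have to be processed. -/
structure Bfs (inc : ℕ → ℕ → Prop) (n m : ℕ) (lev levV par q : ℕ → ℕ) (h t d : ℕ)
    (R U : Finset ℕ) (PV : ℕ → Prop) (PF : ℕ → ℕ → Prop) : Prop where
  h_le : h ≤ t
  q_lt : ∀ i < t, q i < m
  q_lev : ∀ i < t, lev (q i) ≠ 0
  q_inj : ∀ i < t, ∀ j < t, q i = q j → i = j
  q_surj : ∀ e, lev e ≠ 0 → ∃ i < t, q i = e
  mono : ∀ i j, i ≤ j → j < t → lev (q i) ≤ lev (q j)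
  upper : ∀ i < t, lev (q i) ≤ d + 1
  lower : ∀ i, h ≤ i + 1 → i < t → d ≤ lev (q i)
  d_pos : 1 ≤ d
  root : lev 0 = 1
  par : ∀ e, lev e ≠ 0 → e ≠ 0 → inc (par e) e ∧ levV (par e) ≠ 0 ∧ lev e = levV (par e) + 1
  exists_eq : ∀ v, levV v ≠ 0 → ∃ e, inc v e ∧ lev e = levV v
  lev_le : ∀ v f, levV v ≠ 0 → inc v f → lev f ≠ 0 → levV v ≤ lev f ∧ lev f ≤ levV v + 1
  lev_zero : ∀ v f, levV v ≠ 0 → inc v f → lev f = 0 → PF v f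
  done : ∀ i v, i < h → inc v (q i) → levV v = 0 → i + 1 = h ∧ PV v
  queue_mem : ∀ i, h ≤ i → i < t → q i ∈ R
  unvisited_mem : ∀ e < m, lev e = 0 → e ∈ R
  vertex_mem : ∀ v < n, levV v = 0 → v ∈ U

namespace Bfs

variable {inc : ℕ → ℕ → Prop} {n m : ℕ} {lev levV par q : ℕ → ℕ} {h t d : ℕ} {R U : Finset ℕ}
  {PV PV' : ℕ → Prop} {PF PF' : ℕ → ℕ → Prop}

theorem init (hm : 0 < m) (hq : q 0 = 0) : Bfs inc n m (Function.update (fun _ => 0) 0 1)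
    (fun _ => 0) par q 0 1 1 (Finset.range m) (Finset.range n) (fun _ => False)
    (fun _ _ => False) where
  h_le := by omega
  q_lt i hi := by obtain rfl : i = 0 := by omega
                  omega
  q_lev i hi := by obtain rfl : i = 0 := by omega
                   simp [hq]
  q_inj := by omega
  q_surj e he := by
    rw [Function.update_apply] at he
    split at he
    · exact ⟨0, by omega, by omega⟩
    · exact absurd rfl he
  mono i j hij hj := by
    obtain rfl : i = j := by omega
    exact le_rfl
  upper i hi := by
    rw [Function.update_apply]
    split <;> omega
  lower i _ hi := by
    obtain rfl : i = 0 := by omega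
    simp [hq]
  d_pos := le_rfl
  root := by simp
  par e he he0 := by simp [he0] at he
  exists_eq v hv := absurd rfl hv
  lev_le v f hv := absurd rfl hv
  lev_zero v f hv := absurd rfl hv
  done i v hi := by omega
  queue_mem i _ hi := by
    obtain rfl : i = 0 := by omega
    simp [hq, hm]
  unvisited_mem e he _ := Finset.mem_range.2 he
  vertex_mem v hv _ := Finset.mem_range.2 hv

/-- Pending work matters only while its target is unvisited; items found already visited can be
struck off for free. -/
theorem weaken (B : Bfs inc n m lev levV par q h t d R U PV PF)
    (hPV : ∀ v, levV v = 0 → PV v → PV' v) (hPF : ∀ v f, lev f = 0 → PF v f → PF' v f) :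
    Bfs inc n m lev levV par q h t d R U PV' PF' :=
  { B with
    lev_zero := fun v f hv hvf hf => hPF v f hf (B.lev_zero v f hv hvf hf)
    done := fun i v hi hv h0 => (B.done i v hi hv h0).imp_right (hPV v h0) }

/-- The current level `d` becomes that of the removed hyperedge, all of whose vertices become
pending. -/
theorem pop (B : Bfs inc n m lev levV par q h t d R U (fun _ => False) PF) (hlt : h < t) :
    Bfs inc n m lev levV par q (h + 1) t (lev (q h)) (R.erase (q h)) U
      (fun v => inc v (q h)) PF :=
  { B with
    h_le := hlt
    upper := fun i hi => (B.upper i hi).trans (by have := B.lower h (by omega) hlt; omega)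
    lower := fun i hi hit => B.mono h i (by omega) hit
    d_pos := by have := B.q_lev h hlt; omega
    done := fun i v hi hv h0 => by
      by_cases hih : i = h
      · subst hih; exact ⟨rfl, hv⟩
      · exact (B.done i v (by omega) hv h0).2.elim
    queue_mem := fun i hi hit => Finset.mem_erase.2
      ⟨fun heq => by have := B.q_inj i hit h hlt heq; omega, B.queue_mem i (by omega) hit⟩
    unvisited_mem := fun e he h0 => Finset.mem_erase.2
      ⟨fun heq => B.q_lev h hlt (heq ▸ h0), B.unvisited_mem e he h0⟩ }

theorem visit (B : Bfs inc n m lev levV par q h t d R U PV (fun _ _ => False)) {e v : ℕ}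
    (hv : levV v = 0) (hve : inc v e) (he : lev e = d) :
    Bfs inc n m lev (Function.update levV v d) par q h t d R (U.erase v)
      (fun w => PV w ∧ w ≠ v) (fun w f => w = v ∧ inc v f) := by
  have hd := B.d_pos
  -- As `v` was unvisited, by `done` a visited hyperedge at `v` is still in the queue or is the one
  -- just removed; `lower` covers index `h - 1` for this reason.
  have hle : ∀ f, inc v f → lev f ≠ 0 → d ≤ lev f ∧ lev f ≤ d + 1 := by
    intro f hvf hf
    obtain ⟨i, hi, rfl⟩ := B.q_surj f hf
    refine ⟨?_, B.upper i hi⟩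
    by_cases hih : i < h
    · exact B.lower i (B.done i v hih hvf hv).1.ge hi
    · exact B.lower i (by omega) hi
  refine { B with
    par := fun f hf hf0 => ?_
    exists_eq := fun w hw => ?_
    lev_le := fun w f hw hwf hf => ?_
    lev_zero := fun w f hw hwf hf => ?_
    done := fun i w hi hw h0 => ?_
    vertex_mem := fun w hw h0 => ?_ }
  · obtain ⟨h1, h2, h3⟩ := B.par f hf hf0
    rw [Function.update_of_ne (fun heq => h2 (by rw [heq, hv]))]
    exact ⟨h1, h2, h3⟩
  · by_cases hwv : w = v
    · subst hwv
      exact ⟨e, hve, by rw [Function.update_self, he]⟩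
    · rw [Function.update_of_ne hwv] at hw ⊢
      exact B.exists_eq w hw
  · by_cases hwv : w = v
    · subst hwv
      rw [Function.update_self]
      exact hle f hwf hf
    · rw [Function.update_of_ne hwv] at hw ⊢
      exact B.lev_le w f hw hwf hf
  · by_cases hwv : w = v
    · subst hwv
      exact ⟨rfl, hwf⟩
    · rw [Function.update_of_ne hwv] at hw
      exact (B.lev_zero w f hw hwf hf).elim
  · by_cases hwv : w = v
    · subst hwv
      rw [Function.update_self] at h0
      omega
    · rw [Function.update_of_ne hwv] at h0
      exact (B.done i w hi hw h0).imp_right fun hp => ⟨hp, hwv⟩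
  · by_cases hwv : w = v
    · subst hwv
      rw [Function.update_self] at h0
      omega
    · rw [Function.update_of_ne hwv] at h0
      exact Finset.mem_erase.2 ⟨hwv, B.vertex_mem w hw h0⟩

/-- By `hPF`, the only visited vertex in the unvisited `f` can be `v`, at level `d`; so level `d +
1` fits every visited vertex of `f` and keeps the queue sorted. -/
theorem push (B : Bfs inc n m lev levV par q h t d R U PV PF) {f v : ℕ} (hf : lev f = 0)
    (hfm : f < m) (hvf : inc v f) (hv : levV v = d) (hPF : ∀ w g, PF w g → w = v) :
    Bfs inc n m (Function.update lev f (d + 1)) levV (Function.update par f v)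
      (Function.update q t f) h (t + 1) d R U PV (fun w g => PF w g ∧ g ≠ f) := by
  have hd := B.d_pos
  have hqf : ∀ i < t, q i ≠ f := fun i hi heq => B.q_lev i hi (heq ▸ hf)
  have hq : ∀ i < t, Function.update q t f i = q i := fun i hi =>
    Function.update_of_ne (by omega) _ _
  have hql : ∀ i < t, Function.update lev f (d + 1) (Function.update q t f i) = lev (q i) :=
    fun i hi => by rw [hq i hi, Function.update_of_ne (hqf i hi)]
  have hqt : Function.update lev f (d + 1) (Function.update q t f t) = d + 1 := by simp
  have hlt : ∀ i < t + 1, i = t ∨ i < t := fun i hi => by omega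
  refine ⟨B.h_le.trans (by omega), fun i hi => ?_, fun i hi => ?_, fun i hi j hj hij => ?_,
    fun e he => ?_, fun i j hij hj => ?_, fun i hi => ?_, fun i hi hit => ?_, hd, ?_,
    fun e he he0 => ?_, fun w hw => ?_, fun w g hw hwg hg => ?_, fun w g hw hwg hg => ?_,
    fun i w hi hw h0 => ?_, fun i hi hit => ?_, fun e he h0 => ?_, B.vertex_mem⟩
  · rcases hlt i hi with rfl | hi
    · simpa using hfm
    · rw [hq i hi]; exact B.q_lt i hi
  · rcases hlt i hi with rfl | hi
    · rw [hqt]; omega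
    · rw [hql i hi]; exact B.q_lev i hi
  · rcases hlt i hi with rfl | hi <;> rcases hlt j hj with rfl | hj
    · rfl
    · rw [Function.update_self, hq j hj] at hij
      exact absurd hij.symm (hqf j hj)
    · rw [Function.update_self, hq i hi] at hij
      exact absurd hij (hqf i hi)
    · rw [hq i hi, hq j hj] at hij
      exact B.q_inj i hi j hj hij
  · by_cases hef : e = f
    · exact ⟨t, by omega, by simp [hef]⟩
    · rw [Function.update_of_ne hef] at he
      obtain ⟨i, hi, rfl⟩ := B.q_surj e he
      exact ⟨i, by omega, hq i hi⟩
  · rcases hlt j hj with rfl | hj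
    · rw [hqt]
      rcases hlt i (by omega) with rfl | hi
      · rw [hqt]
      · rw [hql i hi]; exact B.upper i hi
    · rw [hql i (by omega), hql j hj]; exact B.mono i j hij hj
  · rcases hlt i hi with rfl | hi
    · rw [hqt]
    · rw [hql i hi]; exact B.upper i hi
  · rcases hlt i hit with rfl | hit
    · rw [hqt]; omega
    · rw [hql i hit]; exact B.lower i hi hit
  · rw [Function.update_of_ne (fun h0 => by have := B.root; rw [h0] at this; omega)]
    exact B.root
  · by_cases hef : e = f
    · subst hef
      rw [Function.update_self, Function.update_self, hv]
      exact ⟨hvf, by omega, rfl⟩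
    · rw [Function.update_of_ne hef] at he ⊢
      rw [Function.update_of_ne hef]
      exact B.par e he he0
  · obtain ⟨e, he, hl⟩ := B.exists_eq w hw
    exact ⟨e, he, by rw [Function.update_of_ne (fun h0 => by rw [h0] at hl; omega)]; exact hl⟩
  · by_cases hgf : g = f
    · subst hgf
      rw [Function.update_self, hPF w g (B.lev_zero w g hw hwg hf), hv]
      omega
    · rw [Function.update_of_ne hgf] at hg ⊢
      exact B.lev_le w g hw hwg hg
  · by_cases hgf : g = f
    · subst hgf
      rw [Function.update_self] at hg
      omega
    · rw [Function.update_of_ne hgf] at hg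
      exact ⟨B.lev_zero w g hw hwg hg, hgf⟩
  · have := B.h_le
    rw [hq i (by omega)] at hw
    exact B.done i w hi hw h0
  · rcases hlt i hit with rfl | hit
    · rw [Function.update_self]
      exact B.unvisited_mem f hfm hf
    · rw [hq i hit]
      exact B.queue_mem i hi hit
  · by_cases hef : e = f
    · subst hef
      exact B.unvisited_mem e hfm hf
    · rw [Function.update_of_ne hef] at h0
      exact B.unvisited_mem e he h0

end Bfs

end RAM

/-! ### Building the incidence lists -/

namespace RAM

/-- The memory holds the incident pairs `(a₀ k, a₁ k)`, `k < N`, and linked lists of the hyperedges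
at each vertex and of the vertices in each hyperedge. -/
structure Frame (a₀ a₁ : ℕ → ℕ) (m N : ℕ) (s : Memory) : Prop where
  reg_one : s.reg 1 = m
  reg_two : s.reg 2 = N
  reg_four : s.reg 4 = 0
  arr_zero : s.arr 0 = a₀
  arr_one : s.arr 1 = a₁
  chainV : ∀ v, Chain (s.arr 5) a₁ (s.arr 4 v) (bucket a₀ a₁ N v)
  chainE : ∀ e, Chain (s.arr 7) a₀ (s.arr 6 e) (bucket a₁ a₀ N e)

theorem Frame.congr {a₀ a₁ : ℕ → ℕ} {m N : ℕ} {s s' : Memory} (hF : Frame a₀ a₁ m N s)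
    (h : (s'.reg 1 = s.reg 1 ∧ s'.reg 2 = s.reg 2 ∧ s'.reg 4 = s.reg 4) ∧ s'.arr 0 = s.arr 0 ∧
      s'.arr 1 = s.arr 1 ∧ s'.arr 4 = s.arr 4 ∧ s'.arr 5 = s.arr 5 ∧ s'.arr 6 = s.arr 6 ∧
      s'.arr 7 = s.arr 7) : Frame a₀ a₁ m N s' := by
  obtain ⟨⟨h1, h2, h4⟩, k0, k1, k4, k5, k6, k7⟩ := h
  obtain ⟨r1, r2, r4, b0, b1, c1, c2⟩ := hF
  refine ⟨h1 ▸ r1, h2 ▸ r2, h4 ▸ r4, k0 ▸ b0, k1 ▸ b1, ?_, ?_⟩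
  · rw [k4, k5]; exact c1
  · rw [k6, k7]; exact c2

/-- Build the linked lists. -/
def buildLists : Program :=
  .loop (.lt 5 2) (block [.load 6 0 5, .load 7 1 5, .succ 8 5, .load 9 4 6, .store 5 5 9,
    .store 4 6 8, .load 9 6 7, .store 7 5 9, .store 6 7 8, .copy 5 8])

theorem buildLists_runs {a₀ a₁ : ℕ → ℕ} {m N K φ : ℕ} {s : Memory} (hr1 : s.reg 1 = m)
    (hr2 : s.reg 2 = N) (hr : ∀ x, 3 ≤ x → s.reg x = 0) (h0 : s.arr 0 = a₀) (h1 : s.arr 1 = a₁)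
    (hz : ∀ a, 2 ≤ a → s.arr a = fun _ => 0) (hφ : 12 * N + 1 + K ≤ φ) :
    Runs buildLists s φ fun ψ s' => Frame a₀ a₁ m N s' ∧ s'.reg 3 = 0 ∧
      (∀ a, 8 ≤ a → s'.arr a = fun _ => 0) ∧ K ≤ ψ := by
  -- A pass costs 12: ten operations, the closing `skip` of the block and the loop test.
  refine Runs.loop (fun φ s => (s.reg 1 = m ∧ s.reg 2 = N ∧ s.reg 3 = 0 ∧ s.reg 4 = 0) ∧
    s.arr 0 = a₀ ∧ s.arr 1 = a₁ ∧ (∀ a, 8 ≤ a → s.arr a = fun _ => 0) ∧ s.reg 5 ≤ N ∧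
    Buckets a₀ a₁ (s.reg 5) (s.arr 4) (s.arr 5) ∧ Buckets a₁ a₀ (s.reg 5) (s.arr 6) (s.arr 7) ∧
    12 * (N - s.reg 5) + 1 + K ≤ φ) ?_ ?_ ?_
  · refine ⟨⟨hr1, hr2, hr 3 le_rfl, hr 4 (by omega)⟩, h0, h1, fun a ha => hz a (by omega),
      by rw [hr 5 (by omega)]; omega, ?_, ?_, by omega⟩
    · rw [hr 5 (by omega), hz 4 (by omega), hz 5 (by omega)]; exact Buckets.zero _ _
    · rw [hr 5 (by omega), hz 6 (by omega), hz 7 (by omega)]; exact Buckets.zero _ _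
  · rintro φ s ⟨⟨r1, r2, r3, r4⟩, b0, b1, hz, hle, hB, hB', hφ⟩ hb
    have h5 : s.reg 5 = N := by
      simp only [Cond.Holds] at hb
      omega
    rw [h5] at hB hB'
    exact ⟨by omega, ⟨r1, r2, r4, b0, b1, hB.chain, hB'.chain⟩, r3, hz, by omega⟩
  · rintro φ s ⟨⟨r1, r2, r3, r4⟩, b0, b1, hz, hle, hB, hB', hφ⟩ hb
    simp only [Cond.Holds, r2] at hb
    refine ⟨by omega, Runs.block _ (by simp; omega) ?_⟩
    have hB := hB.succ
    have hB' := hB'.succ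
    refine ⟨by simp [r1, r2, r3, r4], by simp [b0], by simp [b1], fun a ha => ?_, by simp; omega,
      by simpa [b0, b1] using hB, by simpa [b0, b1] using hB', by simp; omega⟩
    have := hz a ha
    simp [this, show a ≠ 4 by omega, show a ≠ 5 by omega, show a ≠ 6 by omega,
      show a ≠ 7 by omega]

/-! ### Breadth-first search -/

/-- Put the unvisited hyperedges at the vertex in register 6 into the queue. -/
def scanVertex : Program :=
  .loop (.lt 4 9) (.seq (block [.pred 5 9, .load 10 1 5, .load 9 5 5, .load 11 8 10])
    (.ite (.eq 11 4) (block [.store 8 10 15, .store 10 10 6, .store 11 13 10, .succ 13 13]) .skip))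

/-- Visit the unvisited vertices of the hyperedge in register 7. -/
def scanEdge : Program :=
  .loop (.lt 4 8) (.seq (block [.pred 5 8, .load 6 0 5, .load 8 7 5, .load 11 9 6])
    (.ite (.eq 11 4) (.seq (block [.store 9 6 14, .load 9 4 6]) scanVertex) .skip))

/-- Breadth-first search from hyperedge 0. -/
def search : Program :=
  .seq (block [.const 11 1, .store 8 4 11, .const 12 0, .const 13 1, .const 14 1])
    (.loop (.lt 12 13) (.seq
      (block [.load 7 11 12, .succ 12 12, .load 14 8 7, .succ 15 14, .load 8 6 7]) scanEdge))

/-- The incidence relation given by a list of pairs. -/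
def Inc (a₀ a₁ : ℕ → ℕ) (N v e : ℕ) : Prop := ∃ k < N, a₀ k = v ∧ a₁ k = e

/-- The part of the memory that is not changed by the search. -/
structure Kept (s s' : Memory) : Prop where
  reg_three : s'.reg 3 = s.reg 3
  arr_seven : s'.arr 7 = s.arr 7
  arr_twelve : s'.arr 12 = s.arr 12

variable {a₀ a₁ : ℕ → ℕ} {n m N : ℕ}

/-- The memory holds the state of a breadth-first search. -/
def HoldsBfs (a₀ a₁ : ℕ → ℕ) (n m N : ℕ) (R U : Finset ℕ) (PV : ℕ → Prop) (PF : ℕ → ℕ → Prop)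
    (s : Memory) : Prop :=
  Bfs (Inc a₀ a₁ N) n m (s.arr 8) (s.arr 9) (s.arr 10) (s.arr 11) (s.reg 12) (s.reg 13) (s.reg 14)
    R U PV PF

/-- The invariant keeps as pending exactly the unread rest of the vertex's list. Levels already set
stay fixed, which the enclosing loop needs for the hyperedge in register 7. -/
theorem scanVertex_runs {R U : Finset ℕ} {PV : ℕ → Prop} {l : List ℕ} {K φ : ℕ} {s : Memory}
    (hF : Frame a₀ a₁ m N s) (h15 : s.reg 15 = s.reg 14 + 1)
    (hB : HoldsBfs a₀ a₁ n m N R U PV (fun w g => w = s.reg 6 ∧ g ∈ l) s)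
    (h9 : s.arr 9 (s.reg 6) = s.reg 14) (hl : Chain (s.arr 5) a₁ (s.reg 9) l)
    (hlm : ∀ f ∈ l, f < m ∧ Inc a₀ a₁ N (s.reg 6) f) (hφ : 12 * l.length + 1 + K ≤ φ) :
    Runs scanVertex s φ fun ψ s' => Frame a₀ a₁ m N s' ∧
      HoldsBfs a₀ a₁ n m N R U PV (fun _ _ => False) s' ∧ Kept s s' ∧ s'.arr 9 = s.arr 9 ∧
      s'.reg 7 = s.reg 7 ∧ s'.reg 8 = s.reg 8 ∧ s'.reg 14 = s.reg 14 ∧ s'.reg 15 = s.reg 15 ∧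
      (∀ e, s.arr 8 e ≠ 0 → s'.arr 8 e = s.arr 8 e) ∧ K ≤ ψ := by
  have hd := hB.d_pos
  refine Runs.loop (fun φ s' => ∃ l, Frame a₀ a₁ m N s' ∧
      HoldsBfs a₀ a₁ n m N R U PV (fun w g => w = s.reg 6 ∧ g ∈ l) s' ∧
      Kept s s' ∧ s'.arr 9 = s.arr 9 ∧ s'.reg 6 = s.reg 6 ∧
      s'.reg 7 = s.reg 7 ∧ s'.reg 8 = s.reg 8 ∧ s'.reg 14 = s.reg 14 ∧ s'.reg 15 = s.reg 15 ∧
      (∀ e, s.arr 8 e ≠ 0 → s'.arr 8 e = s.arr 8 e) ∧ Chain (s'.arr 5) a₁ (s'.reg 9) l ∧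
      (∀ f ∈ l, f < m ∧ Inc a₀ a₁ N (s.reg 6) f) ∧ 12 * l.length + 1 + K ≤ φ) ?_ ?_ ?_
  · exact ⟨l, hF, hB, ⟨rfl, rfl, rfl⟩, rfl, rfl, rfl, rfl, rfl, rfl, fun _ _ => rfl, hl, hlm, hφ⟩
  · rintro φ s' ⟨l, hF, hB, hK, k9, k6, k7, k8, k14, k15, k, hl, hlm, hφ⟩ hb
    simp only [Cond.Holds, hF.reg_four] at hb
    have hnil : l = [] := by
      by_contra h
      exact hb (hl.pos_iff.2 h)
    subst hnil
    refine ⟨by omega, hF, hB.weaken (fun _ _ h => h) (by simp), hK, k9, k7, k8, k14, k15, k,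
      by omega⟩
  · rintro φ s' ⟨l, hF, hB, hK, k9, k6, k7, k8, k14, k15, k, hl, hlm, hφ⟩ hb
    simp only [Cond.Holds, hF.reg_four] at hb
    obtain ⟨l, rfl, hl'⟩ := hl.exists_of_pos hb
    rw [List.length_cons] at hφ
    have hf := hlm _ List.mem_cons_self
    have hlm' := fun f hf => hlm f (List.mem_cons_of_mem _ hf)
    refine ⟨by omega, Runs.seq (Runs.block _ (by simp; omega) (Runs.ite (by simp; omega) ?_ ?_))⟩
    · intro hz
      simp [hF.reg_four, hF.arr_one] at hz
      refine Runs.block _ (by simp; omega) ⟨l, hF.congr (by simp), ?_, ⟨by simpa using hK.1,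
        by simpa using hK.2, by simpa using hK.3⟩, by simpa, by simpa, by simpa, by simpa, by simpa, by simpa, ?_,
        by simpa, hlm', by simp; omega⟩
      · have := (hB.push hz hf.1 hf.2 (by rw [k9, h9, k14]) (fun w g h => h.1)).weaken
          (PF' := fun w g => w = s.reg 6 ∧ g ∈ l) (fun _ _ h => h) (by
            rintro v f - ⟨⟨rfl, h⟩, hne⟩
            exact ⟨rfl, (List.mem_cons.1 h).resolve_left hne⟩)
        simpa [HoldsBfs, hF.arr_one, k15, h15, k14, k6] using this
      · intro e he
        have := k e he
        have hne : e ≠ a₁ (s'.reg 9 - 1) := by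
          rintro rfl
          rw [hz] at this
          omega
        simpa [hF.arr_one, hne] using this
    · intro hz
      simp [hF.reg_four, hF.arr_one] at hz
      refine Runs.skip (by simp; omega) ⟨l, hF.congr (by simp), ?_, ⟨by simpa using hK.1,
        by simpa using hK.2, by simpa using hK.3⟩, by simpa, by simpa, by simpa, by simpa, by simpa, by simpa,
        by simpa, by simpa, hlm', by simp; omega⟩
      have := hB.weaken (PF' := fun w g => w = s.reg 6 ∧ g ∈ l) (fun _ _ h => h) (by
            rintro v f hf0 ⟨rfl, h⟩
            refine ⟨rfl, (List.mem_cons.1 h).resolve_left ?_⟩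
            rintro rfl
            exact hz hf0)
      simpa [HoldsBfs] using this

end RAM

namespace RAM

variable {a₀ a₁ : ℕ → ℕ} {n m N : ℕ}

/-- Credits for vertex lists are stored in the set `U` of candidates for visiting; erasing a vertex
from `U` releases the cost of scanning its list, which is paid only once. -/
theorem scanEdge_runs (hn : ∀ k < N, a₀ k < n) (hm : ∀ k < N, a₁ k < m) {R U : Finset ℕ}
    {l : List ℕ} {K φ : ℕ} {s : Memory} (hF : Frame a₀ a₁ m N s) (h15 : s.reg 15 = s.reg 14 + 1)
    (hB : HoldsBfs a₀ a₁ n m N R U (fun v => v ∈ l) (fun _ _ => False) s)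
    (h8 : s.arr 8 (s.reg 7) = s.reg 14) (hl : Chain (s.arr 7) a₀ (s.reg 8) l)
    (hle : ∀ v ∈ l, Inc a₀ a₁ N v (s.reg 7))
    (hφ : 12 * l.length + 1 + 12 * ∑ v ∈ U, (bucket a₀ a₁ N v).length + K ≤ φ) :
    Runs scanEdge s φ fun ψ s' => Frame a₀ a₁ m N s' ∧ Kept s s' ∧ ∃ U',
      HoldsBfs a₀ a₁ n m N R U' (fun _ => False) (fun _ _ => False) s' ∧
      12 * ∑ v ∈ U', (bucket a₀ a₁ N v).length + K ≤ ψ := by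
  refine Runs.loop (fun φ s' => ∃ l U, Frame a₀ a₁ m N s' ∧
      HoldsBfs a₀ a₁ n m N R U (fun v => v ∈ l) (fun _ _ => False) s' ∧
      Kept s s' ∧ s'.reg 7 = s.reg 7 ∧ s'.arr 8 (s'.reg 7) = s'.reg 14 ∧
      s'.reg 15 = s'.reg 14 + 1 ∧ Chain (s'.arr 7) a₀ (s'.reg 8) l ∧
      (∀ v ∈ l, Inc a₀ a₁ N v (s.reg 7)) ∧
      12 * l.length + 1 + 12 * ∑ v ∈ U, (bucket a₀ a₁ N v).length + K ≤ φ) ?_ ?_ ?_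
  · exact ⟨l, U, hF, hB, ⟨rfl, rfl, rfl⟩, rfl, h8, h15, hl, hle, hφ⟩
  · rintro φ s' ⟨l, U, hF, hB, hK, k7, h8, h15, hl, hle, hφ⟩ hb
    simp only [Cond.Holds, hF.reg_four] at hb
    have hnil : l = [] := by
      by_contra h
      exact hb (hl.pos_iff.2 h)
    subst hnil
    exact ⟨by omega, hF, hK, U, hB.weaken (by simp) (fun _ _ _ h => h), by omega⟩
  · rintro φ s' ⟨l, U, hF, hB, hK, k7, h8, h15, hl, hle, hφ⟩ hb
    simp only [Cond.Holds, hF.reg_four] at hb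
    obtain ⟨l, rfl, hl'⟩ := hl.exists_of_pos hb
    rw [List.length_cons] at hφ
    have hv := hle _ List.mem_cons_self
    have hle' := fun v hv => hle v (List.mem_cons_of_mem _ hv)
    refine ⟨by omega, Runs.seq (Runs.block _ (by simp; omega) (Runs.ite (by simp; omega) ?_ ?_))⟩
    · intro hz
      simp [hF.reg_four, hF.arr_zero] at hz
      set v := a₀ (s'.reg 8 - 1) with hvdef
      have hvn : v < n := by
        obtain ⟨k, hk, hkv, -⟩ := hv
        rw [← hkv]
        exact hn k hk
      have hU := Finset.add_sum_erase U (fun v => (bucket a₀ a₁ N v).length)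
        (hB.vertex_mem v hvn hz)
      have hB' := (hB.visit hz hv (k7 ▸ h8)).weaken (PV' := fun v => v ∈ l)
        (PF' := fun w g => w = v ∧ g ∈ bucket a₀ a₁ N v)
        (by rintro w - ⟨h, hne⟩; exact (List.mem_cons.1 h).resolve_left hne)
        (by rintro w g - ⟨h, hg⟩; exact ⟨h, mem_bucket.2 hg⟩)
      refine Runs.seq (Runs.block _ (by simp; omega) ?_)
      refine (scanVertex_runs (a₀ := a₀) (a₁ := a₁) (n := n) (m := m) (N := N) (R := R)
        (U := U.erase v) (PV := fun v => v ∈ l) (l := bucket a₀ a₁ N v)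
        (K := 12 * l.length + 1 + 12 * ∑ v ∈ U.erase v, (bucket a₀ a₁ N v).length + K)
        (hF.congr (by simp)) (by simpa) ?_ (by simp) ?_ ?_ ?_).mono ?_
      · simpa [HoldsBfs, hF.arr_zero, ← hvdef] using hB'
      · simpa [hF.arr_zero, ← hvdef] using hF.chainV v
      · intro f hf
        obtain ⟨k, hk, hkv, hkf⟩ := mem_bucket.1 hf
        refine ⟨hkf ▸ hm k hk, ?_⟩
        simpa [hF.arr_zero, ← hvdef] using ⟨k, hk, hkv, hkf⟩
      · simp
        omega
      · rintro ψ s'' ⟨hF', hB'', hK', k9', k7', k8', k14', k15', k', hψ⟩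
        simp at k7' k8' k14' k15' k'
        refine ⟨l, U.erase v, hF', hB'', ⟨by rw [hK'.1]; simpa using hK.1,
          by rw [hK'.2]; simpa using hK.2, by rw [hK'.3]; simpa using hK.3⟩, by rw [k7', k7], ?_, by rw [k15', k14', h15], ?_,
          hle', hψ⟩
        · rw [k7', k14', ← h8]
          apply k'
          have := hB.d_pos
          omega
        · rw [k8', hK'.2]
          simpa [hF.arr_zero] using hl'
    · intro hz
      simp [hF.reg_four, hF.arr_zero] at hz
      refine Runs.skip (by simp; omega) ⟨l, U, hF.congr (by simp), ?_, ⟨by simpa using hK.1,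
        by simpa using hK.2, by simpa using hK.3⟩, by simpa, by simpa, by simpa, by simpa [hF.arr_zero] using hl',
        hle', by simp; omega⟩
      have := hB.weaken (PV' := fun v => v ∈ l) (by
            rintro v h0 h
            refine (List.mem_cons.1 h).resolve_left ?_
            rintro rfl
            exact hz h0) (fun _ _ _ h => h)
      simpa [HoldsBfs] using this

theorem search_runs (hn : ∀ k < N, a₀ k < n) (hm : ∀ k < N, a₁ k < m) (hm0 : 0 < m) {K φ : ℕ}
    {s : Memory} (hF : Frame a₀ a₁ m N s) (h8 : s.arr 8 = fun _ => 0) (h9 : s.arr 9 = fun _ => 0)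
    (h11 : s.arr 11 = fun _ => 0) (hφ : 10 * m + 24 * N + 7 + K ≤ φ) :
    Runs search s φ fun ψ s' => Frame a₀ a₁ m N s' ∧ Kept s s' ∧ s'.reg 12 = s'.reg 13 ∧
      (∃ R U, HoldsBfs a₀ a₁ n m N R U (fun _ => False) (fun _ _ => False) s') ∧ K ≤ ψ := by
  refine Runs.seq (Runs.block _ (by simp; omega) ?_)
  -- Each hyperedge in `R` holds 10 credits plus 12 per cell of its list, and each vertex in `U`
  -- holds 12 per cell of its list. Initially both kinds of list have total length `N`.
  refine Runs.loop (fun φ s' => ∃ R U, Frame a₀ a₁ m N s' ∧ Kept s s' ∧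
    HoldsBfs a₀ a₁ n m N R U (fun _ => False) (fun _ _ => False) s' ∧
    ∑ e ∈ R, (10 + 12 * (bucket a₁ a₀ N e).length) +
      12 * ∑ v ∈ U, (bucket a₀ a₁ N v).length + 1 + K ≤ φ) ?_ ?_ ?_
  · refine ⟨Finset.range m, Finset.range n, hF.congr (by simp), ⟨by simp, by simp, by simp⟩,
      ?_, ?_⟩
    · have := Bfs.init (inc := Inc a₀ a₁ N) (n := n) (par := s.arr 10) (q := s.arr 11) hm0
        (by simp [h11])
      simpa [HoldsBfs, hF.reg_four, h8, h9] using this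
    · rw [Finset.sum_add_distrib, ← Finset.mul_sum, sum_length_bucket hm, sum_length_bucket hn]
      simp
      omega
  · rintro φ s' ⟨R, U, hF, hK, hB, hφ⟩ hb
    simp only [Cond.Holds] at hb
    have := hB.h_le
    exact ⟨by omega, hF, hK, by omega, ⟨R, U, hB⟩, by omega⟩
  · rintro φ s' ⟨R, U, hF, hK, hB, hφ⟩ hb
    simp only [Cond.Holds] at hb
    have hR := Finset.add_sum_erase R (fun e => 10 + 12 * (bucket a₁ a₀ N e).length)
      (hB.queue_mem _ le_rfl hb)
    refine ⟨by omega, Runs.seq (Runs.block _ (by simp; omega) ?_)⟩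
    set e := s'.arr 11 (s'.reg 12) with he
    have hB' := (hB.pop hb).weaken (PV' := fun v => v ∈ bucket a₁ a₀ N e)
      (fun v _ ⟨k, hk, hkv, hke⟩ => mem_bucket.2 ⟨k, hk, hke, hkv⟩) (fun _ _ _ h => h)
    refine (scanEdge_runs (a₀ := a₀) (a₁ := a₁) (N := N) (R := R.erase e) (U := U)
      (l := bucket a₁ a₀ N e)
      (K := ∑ e ∈ R.erase e, (10 + 12 * (bucket a₁ a₀ N e).length) + 1 + K) hn hm
      (hF.congr (by simp)) (by simp) ?_ (by simp) ?_ ?_ ?_).mono ?_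
    · simpa [HoldsBfs, ← he] using hB'
    · simpa [← he] using hF.chainE e
    · intro v hv
      obtain ⟨k, hk, hke, hkv⟩ := mem_bucket.1 hv
      simpa [← he] using ⟨k, hk, hkv, hke⟩
    · simp
      omega
    · rintro ψ s'' ⟨hF', hK', U', hB'', hψ⟩
      exact ⟨R.erase e, U', hF', ⟨by rw [hK'.1]; simpa using hK.1,
        by rw [hK'.2]; simpa using hK.2, by rw [hK'.3]; simpa using hK.3⟩, hB'', by omega⟩

end RAM

/-! ### Counting the vertices that are closer to the root -/

namespace RAM

variable {a₀ a₁ : ℕ → ℕ} {m N : ℕ}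

/-- The number of pairs with index less than `K` of `e` and a vertex of lower level. -/
def downCount (a₀ a₁ lev levV : ℕ → ℕ) (K e : ℕ) : ℕ :=
  ((Finset.range K).filter fun k => a₁ k = e ∧ levV (a₀ k) < lev e).card

theorem downCount_succ (a₀ a₁ lev levV : ℕ → ℕ) (K e : ℕ) :
    downCount a₀ a₁ lev levV (K + 1) e = if a₁ K = e ∧ levV (a₀ K) < lev e then
      downCount a₀ a₁ lev levV K e + 1 else downCount a₀ a₁ lev levV K e := by
  rw [downCount, Finset.range_add_one, Finset.filter_insert]
  split <;> simp [downCount]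

/-- Compute `downCount` for all hyperedges. -/
def countDown : Program :=
  .seq (block [.const 5 0]) (.loop (.lt 5 2) (.seq
    (block [.load 6 0 5, .load 7 1 5, .load 8 9 6, .load 9 8 7, .succ 5 5])
    (.ite (.lt 8 9) (block [.load 10 12 7, .succ 10 10, .store 12 7 10]) .skip)))

theorem countDown_runs {K φ : ℕ} {s : Memory} (hF : Frame a₀ a₁ m N s)
    (h12 : s.arr 12 = fun _ => 0) (hφ : 12 * N + 3 + K ≤ φ) :
    Runs countDown s φ fun ψ s' => Frame a₀ a₁ m N s' ∧ s'.reg 3 = s.reg 3 ∧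
      s'.arr 8 = s.arr 8 ∧ s'.arr 10 = s.arr 10 ∧
      s'.arr 12 = downCount a₀ a₁ (s.arr 8) (s.arr 9) N ∧ K ≤ ψ := by
  refine Runs.seq (Runs.block _ (by simp; omega) ?_)
  refine Runs.loop (fun φ s' => Frame a₀ a₁ m N s' ∧ s'.reg 3 = s.reg 3 ∧
      s'.arr 8 = s.arr 8 ∧ s'.arr 9 = s.arr 9 ∧ s'.arr 10 = s.arr 10 ∧ s'.reg 5 ≤ N ∧
      s'.arr 12 = downCount a₀ a₁ (s.arr 8) (s.arr 9) (s'.reg 5) ∧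
      12 * (N - s'.reg 5) + 1 + K ≤ φ) ?_ ?_ ?_
  · refine ⟨hF.congr (by simp), by simp, by simp, by simp, by simp, by simp, ?_, by simp; omega⟩
    funext e
    simp [h12, downCount]
  · rintro φ s' ⟨hF, k3, k8, k9, k10, hle, hc, hφ⟩ hb
    simp only [Cond.Holds, hF.reg_two] at hb
    have h5 : s'.reg 5 = N := by omega
    rw [h5] at hc
    exact ⟨by omega, hF, k3, k8, k10, hc, by omega⟩
  · rintro φ s' ⟨hF, k3, k8, k9, k10, hle, hc, hφ⟩ hb
    simp only [Cond.Holds, hF.reg_two] at hb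
    refine ⟨by omega, Runs.seq (Runs.block _ (by simp; omega) (Runs.ite (by simp; omega) ?_ ?_))⟩
    · intro hz
      simp [hF.arr_zero, hF.arr_one, k8, k9] at hz
      refine Runs.block _ (by simp; omega) ⟨hF.congr (by simp), by simpa, by simpa, by simpa,
        by simpa, by simp; omega, ?_, by simp; omega⟩
      funext e
      by_cases he : e = a₁ (s'.reg 5)
      · subst he
        simp [hF.arr_zero, hF.arr_one, downCount_succ, hc, hz]
      · simp [hF.arr_zero, hF.arr_one, downCount_succ, hc, he, Ne.symm he]
    · intro hz
      simp [hF.arr_zero, hF.arr_one, k8, k9] at hz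
      refine Runs.skip (by simp; omega) ⟨hF.congr (by simp), by simpa, by simpa, by simpa,
        by simpa, by simp; omega, ?_, by simp; omega⟩
      funext e
      by_cases he : a₁ (s'.reg 5) = e
      · subst he
        simp [downCount_succ, hc, hz]
      · simp [downCount_succ, hc, he]

/-! ### Listing the pairs of intersecting hyperedges -/

/-- Order by level, then by decreasing count, then by index. -/
def Before (lev cnt : ℕ → ℕ) (f e : ℕ) : Prop :=
  lev f < lev e ∨ lev f = lev e ∧ (cnt e < cnt f ∨ cnt e = cnt f ∧ f < e)

/-- Test whether the hyperedge in register 10 is before the one in register 7. -/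
def testBefore : Program :=
  .ite (.lt 11 14) (.op (.const 13 1)) (.ite (.eq 11 14)
    (.ite (.lt 15 12) (.op (.const 13 1)) (.ite (.eq 15 12)
      (.ite (.lt 10 7) (.op (.const 13 1)) (.op (.const 13 0))) (.op (.const 13 0))))
    (.op (.const 13 0)))

theorem Runs.op {o : Op} {s : Memory} {φ : ℕ} {Q : ℕ → Memory → Prop} (hφ : 1 ≤ φ)
    (h : Q (φ - 1) (o.apply s)) : Runs (.op o) s φ Q :=
  ⟨1, _, φ - 1, .op o s, by omega, h⟩

theorem testBefore_runs {lev cnt : ℕ → ℕ} {K φ : ℕ} {s : Memory}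
    (h11 : s.reg 11 = lev (s.reg 10)) (h14 : s.reg 14 = lev (s.reg 7))
    (h12 : s.reg 12 = cnt (s.reg 10)) (h15 : s.reg 15 = cnt (s.reg 7)) (hφ : 6 + K ≤ φ) :
    Runs testBefore s φ fun ψ s' => ∃ x, s' = s.setReg 13 x ∧
      (0 < x ↔ Before lev cnt (s.reg 10) (s.reg 7)) ∧ K ≤ ψ := by
  unfold testBefore Before
  rw [← h11, ← h14, ← h12, ← h15]
  refine Runs.ite (by omega) (fun h1 => ?_) fun h1 => Runs.ite (by omega) (fun h2 =>
    Runs.ite (by omega) (fun h3 => ?_) fun h3 => Runs.ite (by omega) (fun h4 =>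
    Runs.ite (by omega) (fun h5 => ?_) fun h5 => ?_) fun h4 => ?_) fun h2 => ?_
  all_goals
    simp only [Cond.Holds] at *
    exact Runs.op (by omega) ⟨_, rfl, by omega, by omega⟩

/-- Append the pair of registers 10 and 7 to the output if register 13 is positive. -/
def emit : Program :=
  .ite (.lt 4 13) (block [.store 2 3 10, .store 3 3 7, .succ 3 3]) .skip

/-- List the pairs of the hyperedge in register 7 with preceding hyperedges at its parent. -/
def listEdge : Program :=
  .loop (.lt 4 9) (.seq
    (block [.pred 5 9, .load 10 1 5, .load 9 5 5, .load 11 8 10, .load 12 12 10])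
    (.seq testBefore emit))

/-- List all pairs of intersecting hyperedges. -/
def listAll : Program :=
  .seq (block [.const 7 1]) (.loop (.lt 7 1) (.seq
    (block [.load 6 10 7, .load 9 4 6, .load 14 8 7, .load 15 12 7])
    (.seq listEdge (block [.succ 7 7]))))

/-- The memory holds the list of pairs `O` as output. -/
def HoldsPairs (O : List (ℕ × ℕ)) (s : Memory) : Prop :=
  s.reg 3 = O.length ∧ ∀ (k : ℕ) (h : k < O.length), s.arr 2 k = O[k].1 ∧ s.arr 3 k = O[k].2

/-- The part of the memory that is not changed by the output. -/
structure Same (s s' : Memory) : Prop where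
  reg_seven : s'.reg 7 = s.reg 7
  arr_eight : s'.arr 8 = s.arr 8
  arr_ten : s'.arr 10 = s.arr 10
  arr_twelve : s'.arr 12 = s.arr 12

/-- `L₀` is the whole list at the parent, `l` its unread rest, and `B` describes the pairs treated
in earlier rounds. As `l` has no repetitions and `B` excludes its entries, no pair is emitted twice.
-/
theorem listEdge_runs {l L₀ : List ℕ} {B : ℕ → ℕ → Prop} {O : List (ℕ × ℕ)} {K φ : ℕ} {s : Memory}
    (hF : Frame a₀ a₁ m N s) (h14 : s.reg 14 = s.arr 8 (s.reg 7))
    (h15 : s.reg 15 = s.arr 12 (s.reg 7)) (hl : Chain (s.arr 5) a₁ (s.reg 9) l) (hnd : l.Nodup)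
    (hO : HoldsPairs O s) (hOnd : O.Nodup)
    (hmem : ∀ f x, (f, x) ∈ O ↔ Before (s.arr 8) (s.arr 12) f x ∧
      (B f x ∨ x = s.reg 7 ∧ f ∈ L₀ ∧ f ∉ l)) (hsub : ∀ f ∈ l, f ∈ L₀ ∧ ¬ B f (s.reg 7))
    (hφ : 20 * l.length + 1 + K ≤ φ) :
    Runs listEdge s φ fun ψ s' => Frame a₀ a₁ m N s' ∧ Same s s' ∧ K ≤ ψ ∧
      ∃ O, HoldsPairs O s' ∧ O.Nodup ∧ ∀ f x, (f, x) ∈ O ↔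
        Before (s.arr 8) (s.arr 12) f x ∧ (B f x ∨ x = s.reg 7 ∧ f ∈ L₀) := by
  refine Runs.loop (fun φ s' => ∃ l O, Frame a₀ a₁ m N s' ∧ Same s s' ∧ s'.reg 14 = s.reg 14 ∧
    s'.reg 15 = s.reg 15 ∧ Chain (s'.arr 5) a₁ (s'.reg 9) l ∧ l.Nodup ∧ HoldsPairs O s' ∧
    O.Nodup ∧ (∀ f x, (f, x) ∈ O ↔ Before (s.arr 8) (s.arr 12) f x ∧
      (B f x ∨ x = s.reg 7 ∧ f ∈ L₀ ∧ f ∉ l)) ∧ (∀ f ∈ l, f ∈ L₀ ∧ ¬ B f (s.reg 7)) ∧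
    20 * l.length + 1 + K ≤ φ) ?_ ?_ ?_
  · exact ⟨l, O, hF, ⟨rfl, rfl, rfl, rfl⟩, rfl, rfl, hl, hnd, hO, hOnd, hmem, hsub, hφ⟩
  · rintro φ s' ⟨l, O, hF, hS, k14, k15, hl, hnd, hO, hOnd, hmem, hsub, hφ⟩ hb
    simp only [Cond.Holds, hF.reg_four] at hb
    have hnil : l = [] := by
      by_contra h
      exact hb (hl.pos_iff.2 h)
    subst hnil
    exact ⟨by omega, hF, hS, by omega, O, hO, hOnd, by simpa using hmem⟩
  · rintro φ s' ⟨l, O, hF, hS, k14, k15, hl, hnd, hO, hOnd, hmem, hsub, hφ⟩ hb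
    simp only [Cond.Holds, hF.reg_four] at hb
    obtain ⟨l, rfl, hl'⟩ := hl.exists_of_pos hb
    set f₀ := a₁ (s'.reg 9 - 1) with hf₀
    rw [List.length_cons] at hφ
    obtain ⟨hf₀l, hnd'⟩ := List.nodup_cons.1 hnd
    obtain ⟨hf₀L, hf₀B⟩ := hsub f₀ List.mem_cons_self
    have hsub' := fun f hf => hsub f (List.mem_cons_of_mem _ hf)
    refine ⟨by omega, Runs.seq (Runs.block _ (by simp; omega) (Runs.seq ?_))⟩
    refine (testBefore_runs (lev := s.arr 8) (cnt := s.arr 12) (K := 20 * l.length + 6 + K)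
      (by simp [hS.arr_eight]) (by simp [k14, h14, hS.reg_seven]) (by simp [hS.arr_twelve])
      (by simp [k15, h15, hS.reg_seven]) (by simp; omega)).mono ?_
    rintro ψ _ ⟨x, rfl, hx, hψ⟩
    simp [hF.arr_one, hS.reg_seven, ← hf₀] at hx
    refine Runs.ite (by omega) ?_ ?_
    · intro hz
      simp [hF.reg_four] at hz
      refine Runs.block _ (by simp; omega) ⟨l, O ++ [(f₀, s.reg 7)], hF.congr (by simp),
        ⟨by simpa using hS.1, by simpa using hS.2, by simpa using hS.3, by simpa using hS.4⟩,
        by simpa, by simpa, by simpa [hF.arr_one] using hl', hnd', ?_, ?_, ?_, hsub',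
        by simp; omega⟩
      · refine ⟨by simpa using hO.1, fun k hk => ?_⟩
        rw [List.length_append, List.length_singleton] at hk
        by_cases hkl : k = O.length
        · subst hkl
          simp [hO.1, hF.arr_one, hS.reg_seven, ← hf₀]
        · have hk' : k < O.length := by omega
          rw [List.getElem_append_left hk']
          simpa [hO.1, hkl] using hO.2 k hk'
      · refine List.nodup_append.2 ⟨hOnd, by simp, ?_⟩
        rintro p hp q hq rfl
        rw [List.mem_singleton] at hq
        subst hq
        obtain ⟨-, h | ⟨-, -, h⟩⟩ := (hmem _ _).1 hp
        · exact hf₀B h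
        · exact h List.mem_cons_self
      · intro f x
        rw [List.mem_append, hmem, List.mem_singleton, Prod.mk.injEq, List.mem_cons]
        constructor
        · rintro (⟨h, h' | ⟨h1, h2, h3⟩⟩ | ⟨rfl, rfl⟩)
          · exact ⟨h, .inl h'⟩
          · exact ⟨h, .inr ⟨h1, h2, fun h4 => h3 (.inr h4)⟩⟩
          · exact ⟨hx.1 hz, .inr ⟨rfl, hf₀L, hf₀l⟩⟩
        · rintro ⟨h, h' | ⟨h1, h2, h3⟩⟩
          · exact .inl ⟨h, .inl h'⟩
          · by_cases hff : f = f₀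
            · exact .inr ⟨hff, h1⟩
            · exact .inl ⟨h, .inr ⟨h1, h2, fun h4 => h4.elim hff h3⟩⟩
    · intro hz
      simp [hF.reg_four] at hz
      refine Runs.skip (by omega) ⟨l, O, hF.congr (by simp),
        ⟨by simpa using hS.1, by simpa using hS.2, by simpa using hS.3, by simpa using hS.4⟩,
        by simpa, by simpa, by simpa [hF.arr_one] using hl', hnd', ?_, hOnd, ?_, hsub',
        by omega⟩
      · simpa [HoldsPairs] using hO
      · intro f x
        rw [hmem]
        refine and_congr_right fun h => or_congr_right (and_congr_right fun h1 =>
          and_congr_right fun h2 => not_congr ⟨fun h3 => (List.mem_cons.1 h3).resolve_left ?_,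
            List.mem_cons_of_mem _⟩)
        rintro rfl
        rw [h1] at h
        have := hx.2 h
        omega

theorem listAll_runs (hinj : ∀ j < N, ∀ k < N, a₀ j = a₀ k → a₁ j = a₁ k → j = k) {K φ : ℕ}
    {s : Memory} (hF : Frame a₀ a₁ m N s) (h3 : s.reg 3 = 0)
    (hφ : ∑ e ∈ Finset.Ico 1 m, (9 + 20 * (bucket a₀ a₁ N (s.arr 10 e)).length) + 3 + K ≤ φ) :
    Runs listAll s φ fun ψ s' => s'.reg 1 = m ∧ K ≤ ψ ∧ ∃ O, HoldsPairs O s' ∧ O.Nodup ∧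
      ∀ f x, (f, x) ∈ O ↔ Before (s.arr 8) (s.arr 12) f x ∧
        1 ≤ x ∧ x < m ∧ f ∈ bucket a₀ a₁ N (s.arr 10 x) := by
  refine Runs.seq (Runs.block _ (by simp; omega) ?_)
  -- The alternative `s'.reg 7 = 1` covers `m = 0`, where the counter starts above `m`. The 9
  -- credits per hyperedge are the loop test, the two blocks and the last test of the inner loop.
  refine Runs.loop (fun φ s' => ∃ O, Frame a₀ a₁ m N s' ∧ (s'.arr 8 = s.arr 8 ∧
    s'.arr 10 = s.arr 10 ∧ s'.arr 12 = s.arr 12) ∧ 1 ≤ s'.reg 7 ∧ (s'.reg 7 ≤ m ∨ s'.reg 7 = 1) ∧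
    HoldsPairs O s' ∧ O.Nodup ∧
    (∀ f x, (f, x) ∈ O ↔ Before (s.arr 8) (s.arr 12) f x ∧
      1 ≤ x ∧ x < s'.reg 7 ∧ f ∈ bucket a₀ a₁ N (s.arr 10 x)) ∧
    ∑ e ∈ Finset.Ico (s'.reg 7) m, (9 + 20 * (bucket a₀ a₁ N (s.arr 10 e)).length) + 1 + K ≤ φ)
    ?_ ?_ ?_
  · refine ⟨[], hF.congr (by simp), by simp, by simp, by simp, ⟨by simpa, by simp⟩, by simp, ?_,
      by simp; omega⟩
    intro f x
    simp
    omega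
  · rintro φ s' ⟨O, hF, ⟨k8, k10, k12⟩, h1, hle, hO, hnd, hmem, hφ⟩ hb
    simp only [Cond.Holds, hF.reg_one] at hb
    refine ⟨by omega, hF.reg_one, by omega, O, hO, hnd, fun f x => ?_⟩
    rw [hmem]
    refine and_congr_right fun _ => and_congr_right fun _ => and_congr_left fun _ => ?_
    omega
  · rintro φ s' ⟨O, hF, ⟨k8, k10, k12⟩, h1, hle, hO, hnd, hmem, hφ⟩ hb
    simp only [Cond.Holds, hF.reg_one] at hb
    rw [Finset.sum_eq_sum_Ico_succ_bot hb] at hφ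
    refine ⟨by omega, Runs.seq (Runs.block _ (by simp; omega) (Runs.seq ?_))⟩
    set e := s'.reg 7 with he
    refine (listEdge_runs (a₀ := a₀) (a₁ := a₁) (m := m) (N := N)
      (l := bucket a₀ a₁ N (s.arr 10 e)) (L₀ := bucket a₀ a₁ N (s.arr 10 e)) (O := O)
      (B := fun f x => 1 ≤ x ∧ x < e ∧ f ∈ bucket a₀ a₁ N (s.arr 10 x))
      (K := ∑ e ∈ Finset.Ico (e + 1) m, (9 + 20 * (bucket a₀ a₁ N (s.arr 10 e)).length) + 3 + K)
      (hF.congr (by simp)) (by simp) (by simp)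
      (by simpa [k10, ← he] using hF.chainV _) (bucket_nodup hinj)
      (by simpa [HoldsPairs] using hO) hnd ?_ ?_ (by simp; omega)).mono ?_
    · intro f x
      simpa [k8, k12] using hmem f x
    · intro f hf
      exact ⟨hf, fun h => by simp [← he] at h⟩
    · rintro ψ s'' ⟨hF', hS', hψ, O', hO', hnd', hmem'⟩
      have hS7 := hS'.1
      have hS8 := hS'.2
      have hS10 := hS'.3
      have hS12 := hS'.4
      simp [← he] at hS7 hS8 hS10 hS12
      simp [k8, k12, ← he] at hmem'
      refine Runs.block _ (by simp; omega) ⟨O', hF'.congr (by simp), by simp [*], by simp,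
        by simp; omega, by simpa [HoldsPairs] using hO', hnd', ?_, by simp [hS7]; omega⟩
      intro f x
      rw [hmem']
      refine and_congr_right fun _ => ?_
      simp [hS7]
      constructor
      · rintro (⟨h2, h3, h4⟩ | ⟨rfl, h4⟩)
        · exact ⟨h2, by omega, h4⟩
        · exact ⟨h1, by omega, h4⟩
      · rintro ⟨h2, h3, h4⟩
        by_cases hx : x = e
        · subst hx; exact .inr ⟨rfl, h4⟩
        · exact .inl ⟨h2, by omega, h4⟩

end RAM

/-! ### Correctness of the algorithm -/

section Algorithm

open RAM

variable {n m : ℕ} {H : FamHypergraph (Fin n) (Fin m)} {L : List (Fin n × Fin m)}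

theorem inputMemory_arr_zero {k : ℕ} (hk : k < L.length) :
    (inputMemory L).arr 0 k = (L[k]).1 := by
  simp [inputMemory, hk]

theorem inputMemory_arr_one {k : ℕ} (hk : k < L.length) :
    (inputMemory L).arr 1 k = (L[k]).2 := by
  simp [inputMemory, hk]

/-- The incidence relation on natural numbers given by a list of incident pairs. -/
abbrev ListInc (L : List (Fin n × Fin m)) : ℕ → ℕ → Prop :=
  Inc ((inputMemory L).arr 0) ((inputMemory L).arr 1) L.length

theorem FamHypergraph.IsListing.exists_of_listInc (hL : H.IsListing L) {v e : ℕ}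
    (h : ListInc L v e) : ∃ (v' : Fin n) (e' : Fin m), v' ∈ H.edge e' ∧ v' = v ∧ e' = e := by
  obtain ⟨k, hk, rfl, rfl⟩ := h
  refine ⟨(L[k]).1, (L[k]).2, (hL.2 _ _).1 (List.getElem_mem hk), ?_, ?_⟩
  · rw [inputMemory_arr_zero hk]
  · rw [inputMemory_arr_one hk]

theorem FamHypergraph.IsListing.listInc_iff (hL : H.IsListing L) (v : Fin n) (e : Fin m) :
    ListInc L v e ↔ v ∈ H.edge e := by
  constructor
  · intro h
    obtain ⟨v', e', h', hv, he⟩ := hL.exists_of_listInc h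
    rwa [Fin.ext hv, Fin.ext he] at h'
  · intro h
    obtain ⟨k, hk, hkeq⟩ := List.getElem_of_mem ((hL.2 v e).2 h)
    refine ⟨k, hk, ?_, ?_⟩
    · rw [inputMemory_arr_zero hk, hkeq]
    · rw [inputMemory_arr_one hk, hkeq]

theorem inputMemory_injective (hL : L.Nodup) : ∀ j < L.length, ∀ k < L.length,
    (inputMemory L).arr 0 j = (inputMemory L).arr 0 k →
    (inputMemory L).arr 1 j = (inputMemory L).arr 1 k → j = k := by
  intro j hj k hk h0 h1
  rw [inputMemory_arr_zero hj, inputMemory_arr_zero hk] at h0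
  rw [inputMemory_arr_one hj, inputMemory_arr_one hk] at h1
  exact (hL.getElem_inj_iff).1 (Prod.ext (Fin.ext h0) (Fin.ext h1))

theorem FamHypergraph.IsListing.length_eq (hL : H.IsListing L) : L.length = H.totalSize := by
  classical
  rw [← List.toFinset_card_of_nodup hL.1, Finset.card_eq_sum_card_fiberwise (f := Prod.snd)
    (t := Finset.univ) (fun _ _ => Finset.mem_coe.2 (Finset.mem_univ _)), FamHypergraph.totalSize]
  refine Finset.sum_congr rfl fun e _ => ?_
  have himg : H.edge e = Prod.fst '' {p : Fin n × Fin m | p ∈ L ∧ p.2 = e} := by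
    ext v
    constructor
    · intro hv
      exact ⟨(v, e), ⟨(hL.2 v e).2 hv, rfl⟩, rfl⟩
    · rintro ⟨⟨v', e'⟩, ⟨hp, rfl⟩, rfl⟩
      exact (hL.2 _ _).1 hp
  rw [himg, Set.InjOn.ncard_image, ← Set.ncard_coe_finset]
  · congr 1
    ext p
    simp
  · rintro ⟨v, f⟩ ⟨-, rfl⟩ ⟨v', f'⟩ ⟨-, h⟩ hv
    exact Prod.ext hv h.symm

theorem SimpleGraph.Connected.forall_of_adj {W : Type*} {G : SimpleGraph W} (hc : G.Connected)
    {P : W → Prop} {r : W} (hr : P r) (hadj : ∀ x y, G.Adj x y → P x → P y) (x : W) : P x := by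
  obtain ⟨w⟩ := hc.preconnected r x
  induction w with
  | nil => exact hr
  | cons h _ ih => exact ih (hadj _ _ h hr)

/-- A finished breadth-first search has computed the levels. -/
theorem RAM.Bfs.isLevelling (hL : H.IsListing L) (hc : H.incidenceGraph.Connected) (hm : 0 < m)
    {lev levV par q : ℕ → ℕ} {t d : ℕ} {R U : Finset ℕ}
    (B : Bfs (ListInc L) n m lev levV par q t t d R U (fun _ => False) (fun _ _ => False)) :
    H.IsLevelling ⟨0, hm⟩ (fun e => lev e) (fun v => levV v) ∧
      ∀ e : Fin m, (e : ℕ) ≠ 0 → ∃ v : Fin n, (v : ℕ) = par e ∧ v ∈ H.edge e ∧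
        lev e = levV v + 1 := by
  -- With an empty queue and nothing pending, being visited spreads along incidences, hence from the
  -- root to the whole connected graph.
  have hall := hc.forall_of_adj (r := Sum.inr ⟨0, hm⟩)
    (P := Sum.elim (fun v : Fin n => levV v ≠ 0) (fun e : Fin m => lev e ≠ 0))
    (by simp [B.root]) (by
      rintro (v | e) (w | f) h hx
      · exact h.elim
      · intro h0
        exact B.lev_zero v f hx ((hL.listInc_iff v f).2 h) h0
      · intro h0
        obtain ⟨i, hi, hie⟩ := B.q_surj e hx
        exact (B.done i w hi (hie ▸ (hL.listInc_iff w e).2 h) h0).2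
      · exact h.elim)
  have hv : ∀ v : Fin n, levV v ≠ 0 := fun v => hall (Sum.inl v)
  have he : ∀ e : Fin m, lev e ≠ 0 := fun e => hall (Sum.inr e)
  have hpar : ∀ e : Fin m, (e : ℕ) ≠ 0 → ∃ v : Fin n, (v : ℕ) = par e ∧ v ∈ H.edge e ∧
      lev e = levV v + 1 := by
    intro e h0
    obtain ⟨h1, -, h3⟩ := B.par e (he e) h0
    obtain ⟨v, e', hve, hv, he'⟩ := hL.exists_of_listInc h1
    obtain rfl : e' = e := Fin.ext he'
    exact ⟨v, hv, hve, by rw [hv]; exact h3⟩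
  refine ⟨⟨B.root, fun e => Nat.pos_of_ne_zero (he e), fun v e hve => ?_, fun v e hve => ?_,
    fun v => ?_, fun e hne => ?_⟩, hpar⟩
  · exact (B.lev_le v e (hv v) ((hL.listInc_iff v e).2 hve) (he e)).1
  · exact (B.lev_le v e (hv v) ((hL.listInc_iff v e).2 hve) (he e)).2
  · obtain ⟨e, hve, hl⟩ := B.exists_eq v (hv v)
    obtain ⟨v', e', hve', hv', he'⟩ := hL.exists_of_listInc hve
    obtain rfl : v' = v := Fin.ext hv'
    exact ⟨e', hve', by rw [← hl, he']⟩
  · obtain ⟨v, -, hve, hl⟩ := hpar e fun h0 => hne (Fin.ext h0)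
    exact ⟨v, hve, hl⟩

/-- No pair is repeated, so among the indices belonging to `e` the first coordinate is injective,
and counting indices counts vertices. -/
theorem FamHypergraph.IsListing.downCount_eq (hL : H.IsListing L) (lev levV : ℕ → ℕ) (e : Fin m) :
    downCount ((inputMemory L).arr 0) ((inputMemory L).arr 1) lev levV L.length e =
      (H.down (fun e => lev e) (fun v => levV v) e).ncard := by
  rw [← Set.ncard_image_of_injective _ Fin.val_injective, downCount, ← Set.ncard_coe_finset,
    ← Set.InjOn.ncard_image (f := (inputMemory L).arr 0)]
  · congr 1
    ext v
    simp only [Finset.coe_filter, Finset.mem_range, Set.mem_image, Set.mem_ofPred_eq]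
    constructor
    · rintro ⟨k, ⟨hk, hke, hlt⟩, rfl⟩
      obtain ⟨v', e', hve', hv', he'⟩ := hL.exists_of_listInc ⟨k, hk, rfl, hke⟩
      obtain rfl : e' = e := Fin.ext he'
      exact ⟨v', ⟨hve', by simpa [hv'] using hlt⟩, hv'⟩
    · rintro ⟨v, ⟨hve, hlt⟩, rfl⟩
      obtain ⟨k, hk, hkv, hke⟩ := (hL.listInc_iff v e).2 hve
      exact ⟨k, ⟨hk, hke, by rw [hkv]; exact hlt⟩, hkv⟩
  · intro j hj k hk hjk
    simp only [Finset.coe_filter, Finset.mem_range, Set.mem_ofPred_eq] at hj hk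
    exact inputMemory_injective hL.1 j hj.1 k hk.1 hjk (hj.2.1.trans hk.2.1.symm)

/-- The program that computes the line graph of a γ-acyclic hypergraph. -/
def lineGraphProgram : Program :=
  .ite (.lt 4 1) (.seq buildLists (.seq search (.seq countDown listAll))) .skip

/-- The hyperedges at the parents are neighbours in the line graph. -/
theorem sum_length_bucket_le (hL : H.IsListing L) {par : ℕ → ℕ}
    (hpar : ∀ e : Fin m, (e : ℕ) ≠ 0 → ∃ v : Fin n, (v : ℕ) = par e ∧ v ∈ H.edge e) :
    ∑ e ∈ Finset.Ico 1 m, (9 + 20 * (bucket ((inputMemory L).arr 0) ((inputMemory L).arr 1)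
      L.length (par e)).length) ≤ 29 * m + 40 * H.lineGraph.edgeSet.ncard := by
  classical
  set a₀ := (inputMemory L).arr 0
  set a₁ := (inputMemory L).arr 1
  -- Every hyperedge at the parent vertex shares it with `e`, so it is `e` or a neighbour of `e`.
  have hdeg : ∀ e : Fin m, (e : ℕ) ≠ 0 →
      (bucket a₀ a₁ L.length (par e)).length ≤ H.lineGraph.degree e + 1 := by
    intro e he
    obtain ⟨v, hv, hve⟩ := hpar e he
    rw [← List.toFinset_card_of_nodup (bucket_nodup (inputMemory_injective hL.1)),
      ← SimpleGraph.card_neighborFinset_eq_degree, ← Finset.card_insert_of_notMem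
      (SimpleGraph.notMem_neighborFinset_self H.lineGraph e),
      ← Finset.card_image_of_injective _ Fin.val_injective]
    refine Finset.card_le_card fun f hf => ?_
    obtain ⟨v', f', hvf, hv', hf'⟩ := hL.exists_of_listInc (mem_bucket.1 (List.mem_toFinset.1 hf))
    obtain rfl : v' = v := Fin.ext (hv'.trans hv.symm)
    refine Finset.mem_image.2 ⟨f', ?_, hf'⟩
    rw [Finset.mem_insert, SimpleGraph.mem_neighborFinset]
    by_cases hfe : f' = e
    · exact .inl hfe
    · exact .inr ⟨fun h => hfe h.symm, v', hve, hvf⟩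
  have hsum := H.lineGraph.sum_degrees_eq_twice_card_edges
  have hE : H.lineGraph.edgeSet.ncard = H.lineGraph.edgeFinset.card := by
    rw [← SimpleGraph.coe_edgeFinset, Set.ncard_coe_finset]
  set g : ℕ → ℕ := fun e => 9 + 20 * (bucket a₀ a₁ L.length (par e)).length with hg
  -- Here `9 + 20 * (deg + 1) = 29 + 20 * deg`, and the degrees sum to twice the number of edges.
  calc ∑ e ∈ Finset.Ico 1 m, g e
      ≤ ∑ e ∈ Finset.range m, if e = 0 then 0 else g e := by
        rw [Finset.range_eq_Ico]
        refine (Finset.sum_le_sum fun e he => ?_).trans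
          (Finset.sum_le_sum_of_subset (Finset.Ico_subset_Ico_left (Nat.zero_le 1)))
        rw [if_neg (by have := (Finset.mem_Ico.1 he).1; omega)]
    _ = ∑ e : Fin m, if (e : ℕ) = 0 then 0 else g e :=
        Finset.sum_range fun e => if e = 0 then 0 else g e
    _ ≤ ∑ e : Fin m, (29 + 20 * H.lineGraph.degree e) := by
        refine Finset.sum_le_sum fun e _ => ?_
        split
        · omega
        · rename_i h0
          have := hdeg e h0
          simp only [hg]
          omega
    _ = 29 * m + 40 * H.lineGraph.edgeSet.ncard := by
        rw [Finset.sum_add_distrib, ← Finset.mul_sum, hsum, hE]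
        simp
        ring

/-- The pairs of a hyperedge and a preceding hyperedge at its parent are the edges of the line
graph, each listed once. -/
theorem holdsGraph_of_pairs (hL : H.IsListing L) (hc : H.incidenceGraph.Connected)
    (hH : H.IsGammaAcyclic) (hm : 0 < m) {lev levV par : ℕ → ℕ}
    (hlev : H.IsLevelling ⟨0, hm⟩ (fun e => lev e) (fun v => levV v))
    (hpar : ∀ e : Fin m, (e : ℕ) ≠ 0 → ∃ v : Fin n, (v : ℕ) = par e ∧ v ∈ H.edge e ∧
        lev e = levV v + 1) {s : Memory} (h1 : s.reg 1 = m) {O : List (ℕ × ℕ)}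
    (hO : HoldsPairs O s) (hnd : O.Nodup)
    (hmem : ∀ f x, (f, x) ∈ O ↔ Before lev (downCount ((inputMemory L).arr 0)
      ((inputMemory L).arr 1) lev levV L.length) f x ∧ 1 ≤ x ∧ x < m ∧
      f ∈ bucket ((inputMemory L).arr 0) ((inputMemory L).arr 1) L.length (par x)) :
    HoldsGraph s H.lineGraph := by
  set cnt := downCount ((inputMemory L).arr 0) ((inputMemory L).arr 1) lev levV L.length with hcnt
  obtain ⟨L', rfl⟩ : ∃ L' : List (Fin m × Fin m),
      L'.map (Prod.map Fin.val Fin.val) = O := by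
    have : O ∈ Set.range (List.map (Prod.map Fin.val Fin.val : Fin m × Fin m → ℕ × ℕ)) := by
      rw [Set.range_list_map]
      rintro ⟨f, x⟩ hfx
      obtain ⟨-, -, hx, hf⟩ := (hmem f x).1 hfx
      obtain ⟨-, f', -, -, rfl⟩ := hL.exists_of_listInc (mem_bucket.1 hf)
      exact ⟨(f', ⟨x, hx⟩), rfl⟩
    exact this
  have hmem' : ∀ f x : Fin m, (f, x) ∈ L' ↔ Before lev cnt f x ∧ 1 ≤ (x : ℕ) ∧
      ListInc L (par x) f := by
    intro f x
    have := hmem f x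
    rw [mem_bucket] at this
    rw [← List.mem_map_of_injective (Fin.val_injective.prodMap Fin.val_injective) (a := (f, x))]
    refine this.trans ⟨fun h => ⟨h.1, h.2.1, h.2.2.2⟩, fun h => ⟨h.1, h.2.1, x.2, h.2.2⟩⟩
  have hadj : ∀ f x : Fin m, (f, x) ∈ L' → H.lineGraph.Adj f x := by
    intro f x hfx
    obtain ⟨hb, hx, hf⟩ := (hmem' f x).1 hfx
    obtain ⟨v, hv, hve, -⟩ := hpar x (by omega)
    rw [← hv, hL.listInc_iff] at hf
    refine ⟨?_, v, hf, hve⟩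
    rintro rfl
    unfold Before at hb
    omega
  have hadj' : ∀ f x : Fin m, H.lineGraph.Adj f x → Before lev cnt f x → (f, x) ∈ L' := by
    rintro f x ⟨hne, hfx⟩ hb
    have hlt : lev f < lev x ∨ lev f = lev x ∧ cnt x ≤ cnt f := by
      unfold Before at hb
      omega
    -- The root is alone on level 1, so it is never the later hyperedge of a pair and needs no
    -- parent.
    have hx0 : (x : ℕ) ≠ 0 := by
      intro h0
      have hr := hlev.root
      have hf := hlev.pos f
      obtain ⟨v, -, -, hv⟩ := hpar f fun hf0 => hne (Fin.ext (hf0.trans h0.symm))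
      have := hlev.levV_pos v
      simp only at hr hf this
      rw [h0] at hlt
      omega
    obtain ⟨v, hv, hve, hl⟩ := hpar x hx0
    refine (hmem' f x).2 ⟨hb, by omega, ?_⟩
    rw [← hv, hL.listInc_iff]
    refine hlev.down_mem_of_inter hc hH hne.symm hve (by omega)
      (by rwa [Set.inter_comm]) ?_
    rw [← hL.downCount_eq, ← hL.downCount_eq]
    exact hlt
  refine ⟨h1, L', by simpa using hO.1, fun k hk => ?_, ?_, fun z => ?_⟩
  · have := hO.2 k (by simpa using hk)
    rwa [List.getElem_map] at this
  -- An edge listed in both directions would contradict the asymmetry of `Before`.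
  · refine (List.Nodup.of_map _ hnd).map_on ?_
    rintro ⟨f, x⟩ hfx ⟨f', x'⟩ hfx' heq
    rcases Sym2.eq_iff.1 heq with ⟨h, h'⟩ | ⟨h, h'⟩
    · exact Prod.ext h h'
    · simp only at h h'
      subst h h'
      have hb := ((hmem' _ _).1 hfx).1
      have hb' := ((hmem' _ _).1 hfx').1
      unfold Before at hb hb'
      omega
  · induction z with
    | _ f x =>
      rw [SimpleGraph.mem_edgeSet, List.mem_map]
      constructor
      · rintro ⟨⟨f', x'⟩, hfx, heq⟩
        have := hadj _ _ hfx
        rcases Sym2.eq_iff.1 heq with ⟨h, h'⟩ | ⟨h, h'⟩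
        · simp only at h h'
          subst h h'
          exact this
        · simp only at h h'
          subst h h'
          exact this.symm
      · intro h
        have hne : (f : ℕ) ≠ x := fun h' => h.ne (Fin.ext h')
        have htot : Before lev cnt f x ∨ Before lev cnt x f := by
          unfold Before
          omega
        rcases htot with hb | hb
        · exact ⟨_, hadj' _ _ h hb, rfl⟩
        · exact ⟨_, hadj' _ _ h.symm hb, Sym2.eq_swap⟩

/-- With `N` pairs and `k` edges, the four phases need `12N + 1`, `10m + 24N + 7`, `12N + 3` and at
most `29m + 40k + 3` steps, and the first test one more; the factor 50 covers the sum. -/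
theorem lineGraphProgram_runs (hL : H.IsListing L) (hc : H.incidenceGraph.Connected)
    (hH : H.IsGammaAcyclic) :
    Runs lineGraphProgram (inputMemory L)
      (50 * (H.totalSize + (m + H.lineGraph.edgeSet.ncard) + 1))
      fun _ s => HoldsGraph s H.lineGraph := by
  rw [← hL.length_eq]
  refine Runs.ite (by omega) (fun hb => ?_) fun hb => ?_
  · have hm : 0 < m := by simpa [inputMemory] using hb
    have hn' : ∀ k < L.length, (inputMemory L).arr 0 k < n := fun k hk => by
      rw [inputMemory_arr_zero hk]; exact Fin.is_lt _
    have hm' : ∀ k < L.length, (inputMemory L).arr 1 k < m := fun k hk => by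
      rw [inputMemory_arr_one hk]; exact Fin.is_lt _
    refine Runs.seq ((buildLists_runs (m := m) (N := L.length)
      (K := 36 * L.length + 39 * m + 40 * H.lineGraph.edgeSet.ncard + 20) rfl rfl ?_ rfl rfl ?_
      (by omega)).mono ?_)
    · intro x hx
      simp [inputMemory, show x ≠ 0 by omega, show x ≠ 1 by omega, show x ≠ 2 by omega]
    · intro a ha
      funext k
      simp [inputMemory, show a ≠ 0 by omega, show a ≠ 1 by omega]
    rintro ψ s ⟨hF, h3, hz, hψ⟩
    refine Runs.seq ((search_runs (K := 12 * L.length + 29 * m +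
      40 * H.lineGraph.edgeSet.ncard + 10) hn' hm' hm hF (hz 8 (by omega)) (hz 9 (by omega))
      (hz 11 (by omega)) (by omega)).mono ?_)
    rintro ψ s₁ ⟨hF₁, hK₁, heq, ⟨R, U, hB⟩, hψ₁⟩
    rw [HoldsBfs, heq] at hB
    obtain ⟨hlev, hpar⟩ := hB.isLevelling hL hc hm
    refine Runs.seq ((countDown_runs (K := 29 * m + 40 * H.lineGraph.edgeSet.ncard + 5) hF₁
      (by rw [hK₁.arr_twelve, hz 12 (by omega)]) (by omega)).mono ?_)
    rintro ψ s₂ ⟨hF₂, h3₂, h8, h10, h12, hψ₂⟩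
    have hsum := sum_length_bucket_le hL fun e he => (hpar e he).imp fun v hv => ⟨hv.1, hv.2.1⟩
    refine (listAll_runs (K := 0) (inputMemory_injective hL.1) hF₂
      (by rw [h3₂, hK₁.reg_three, h3]) (by rw [h10]; omega)).mono ?_
    rintro ψ s₃ ⟨h1, -, O, hO, hnd, hmem⟩
    rw [h8, h10, h12] at hmem
    exact holdsGraph_of_pairs hL hc hH hm hlev hpar h1 hO hnd hmem
  -- Without hyperedges there is no root to search from, and the empty output is correct.
  · have hm : m = 0 := by simpa [inputMemory] using hb
    subst hm
    refine Runs.skip (by omega) ⟨rfl, [], rfl, fun k hk => absurd hk (by simp), by simp,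
      fun z => ?_⟩
    induction z with
    | _ f x => exact f.elim0

end Algorithm

/-! ### The main theorem -/

theorem mainTheorem10 :
    ∃ (P : RAM.Program) (C : ℕ),
      ∀ (n m : ℕ) (H : FamHypergraph (Fin n) (Fin m)),
        H.incidenceGraph.Connected → H.IsGammaAcyclic →
          (H.unionJoinGraph = H.lineGraph ∧
            H.lineGraph = H.dual.twoSection ∧
            H.dual.IsGammaAcyclic) ∧
          ∀ L : List (Fin n × Fin m), H.IsListing L →
            ∃ (t : ℕ) (s : RAM.Memory),
              RAM.Exec P (inputMemory L) t s ∧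
              t ≤ C * (H.totalSize + graphSize H.unionJoinGraph + 1) ∧
              HoldsGraph s H.unionJoinGraph := by
  refine ⟨lineGraphProgram, 50, fun n m H hc hH => ?_⟩
  have hU := hH.unionJoinGraph_eq_lineGraph hc
  refine ⟨⟨hU, H.lineGraph_eq_dual_twoSection, hH.dual⟩, fun L hL => ?_⟩
  obtain ⟨t, s, ψ, he, hle, hG⟩ := lineGraphProgram_runs hL hc hH
  rw [hU]
  refine ⟨t, s, he, ?_, hG⟩
  rw [graphSize, Nat.card_eq_fintype_card, Fintype.card_fin]
  omega
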